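/- Let $F$ be a field, let $L_1$ and $L_2$ be finite-dimensional Lie algebras over $F$, and let $N_1$ and $N_2$ be ideals of $L_1$ and $L_2$. Let $L_1 * L_2$ denote the free product (coproduct) of Lie algebras, and assume that $N_1 * N_2$, that is, the subalgebra of $L_1 * L_2$ generated by $N_1$ and $N_2$ (the image of the canonical map from the free product of $N_1$ and $N_2$), is an ideal of $L_1 * L_2$. For a Lie algebra $L$ with an ideal $N$, the nonabelian tensor product $L \otimes N$ is the Lie algebra over $F$ generated by the symbols $l \otimes n$ ($l \in L$, $n \in N$) with the defining relations that $l \otimes n$ is $F$-bilinear in $(l,n)$ and that, for all $l, l' \in L$ and $n, n' \in N$, \[ [l,l'] \otimes n = l \otimes [l',n] - l' \otimes [l,n], \quad l \otimes [n,n'] = [n',l] \otimes n - [n,l] \otimes n', \quad [l \otimes n, l' \otimes n'] = -[n,l] \otimes [l',n']. \] Let $J_2(L,N)$ be the kernel of the homomorphism of Lie algebras $L \otimes N \to [L,N]$, $l \otimes n \mapsto [l,n]$. Then the homomorphism $J_2(L_1 * L_2, N_1 * N_2) \to J_2(L_1 \oplus L_2, N_1 \oplus N_2)$ induced by the canonical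 epimorphism $L_1 * L_2 \to L_1 \oplus L_2$ is injective, its image is an ideal, and, with $J_2(L_1 * L_2, N_1 * N_2)$ identified with this image, there is an isomorphism of Lie algebras \[ \frac{J_2(L_1 \oplus L_2, N_1 \oplus N_2)}{J_2(L_1 * L_2, N_1 * N_2)} \simeq \frac{N_1}{[N_1,L_1]} \otimes \frac{N_2}{[N_2,L_2]}, \] where the right-hand side is the nonabelian tensor product of two abelian Lie algebras acting trivially on each other, that is, the usual tensor product over $F$ with zero bracket. -/

import Mathlib

open scoped TensorProduct

universe u v w

noncomputable section

/-! ### Lie algebras given by generators and relations -/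

section Presented

variable {F : Type u} [CommRing F] {X : Type v}

/-- The ideal of the free Lie algebra on `X` generated by all `a - b` with `r a b`. -/
def lieRelIdeal (r : FreeLieAlgebra F X → FreeLieAlgebra F X → Prop) :
    LieIdeal F (FreeLieAlgebra F X) :=
  LieSubmodule.lieSpan F (FreeLieAlgebra F X) {z | ∃ a b, r a b ∧ z = a - b}

/-- The Lie algebra with generators `X` and defining relations `a = b` for `r a b`. -/
abbrev PresentedLie (r : FreeLieAlgebra F X → FreeLieAlgebra F X → Prop) : Type (max u v) :=
  FreeLieAlgebra F X ⧸ lieRelIdeal r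

namespace PresentedLie

variable (r : FreeLieAlgebra F X → FreeLieAlgebra F X → Prop)

/-- The quotient map. -/
def mk : FreeLieAlgebra F X →ₗ⁅F⁆ PresentedLie r :=
  { (LieSubmodule.Quotient.mk' (lieRelIdeal r) :
      FreeLieAlgebra F X →ₗ[F] FreeLieAlgebra F X ⧸ lieRelIdeal r) with
    map_lie' := fun {_ _} => rfl }

/-- The class of a generator. -/
def of (x : X) : PresentedLie r := mk r (FreeLieAlgebra.of F x)

variable {r}

theorem mk_surjective : Function.Surjective (mk r) := Quot.mk_surjective

theorem mk_eq {a b : FreeLieAlgebra F X} (h : r a b) : mk r a = mk r b := by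
  rw [← sub_eq_zero, ← map_sub]
  exact (LieSubmodule.Quotient.mk_eq_zero (N := lieRelIdeal r)).2
    (LieSubmodule.subset_lieSpan ⟨a, b, h, rfl⟩)

variable {M : Type w} [LieRing M] [LieAlgebra F M]

theorem lieRelIdeal_le_ker (f : X → M)
    (hf : ∀ a b, r a b → FreeLieAlgebra.lift F f a = FreeLieAlgebra.lift F f b) :
    lieRelIdeal r ≤ (FreeLieAlgebra.lift F f).ker := by
  refine LieSubmodule.lieSpan_le.2 ?_
  rintro _ ⟨a, b, h, rfl⟩
  simp [hf a b h]

/-- The universal property: a map on generators which respects the relations extends to a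
homomorphism of Lie algebras. -/
def lift (f : X → M)
    (hf : ∀ a b, r a b → FreeLieAlgebra.lift F f a = FreeLieAlgebra.lift F f b) :
    PresentedLie r →ₗ⁅F⁆ M :=
  { (lieRelIdeal r).toSubmodule.liftQ (FreeLieAlgebra.lift F f : FreeLieAlgebra F X →ₗ[F] M)
      (fun _ hx => LieHom.mem_ker.1 (lieRelIdeal_le_ker f hf hx)) with
    map_lie' := by
      intro x y
      obtain ⟨x, rfl⟩ := mk_surjective x
      obtain ⟨y, rfl⟩ := mk_surjective y
      exact LieHom.map_lie (FreeLieAlgebra.lift F f) x y }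

@[simp]
theorem lift_of (f : X → M)
    (hf : ∀ a b, r a b → FreeLieAlgebra.lift F f a = FreeLieAlgebra.lift F f b) (x : X) :
    lift f hf (of r x) = f x :=
  FreeLieAlgebra.lift_of_apply f x

theorem hom_ext {f g : PresentedLie r →ₗ⁅F⁆ M} (h : ∀ x, f (of r x) = g (of r x)) : f = g := by
  have h' : f.comp (mk r) = g.comp (mk r) := FreeLieAlgebra.hom_ext h
  ext x
  obtain ⟨x, rfl⟩ := mk_surjective x
  exact LieHom.congr_fun h' x

end PresentedLie

end Presented

/-! ### The free product of two Lie algebras -/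

section FreeProduct

variable (F : Type u) [CommRing F]
variable (L₁ : Type v) [LieRing L₁] [LieAlgebra F L₁] (L₂ : Type w) [LieRing L₂] [LieAlgebra F L₂]

/-- The generator of the free Lie algebra on the disjoint union of `L₁` and `L₂` given by
`x : L₁`. -/
abbrev lieGenL (x : L₁) : FreeLieAlgebra F (L₁ ⊕ L₂) := FreeLieAlgebra.of F (Sum.inl x)

/-- The generator of the free Lie algebra on the disjoint union of `L₁` and `L₂` given by
`x : L₂`. -/
abbrev lieGenR (x : L₂) : FreeLieAlgebra F (L₁ ⊕ L₂) := FreeLieAlgebra.of F (Sum.inr x)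

/-- The relations which make the maps from `L₁` and `L₂` to the free Lie algebra on the disjoint
union of `L₁` and `L₂` homomorphisms of Lie algebras. -/
inductive LieFreeProductRel : FreeLieAlgebra F (L₁ ⊕ L₂) → FreeLieAlgebra F (L₁ ⊕ L₂) → Prop
  | add_left (x y : L₁) :
      LieFreeProductRel (lieGenL F L₁ L₂ (x + y)) (lieGenL F L₁ L₂ x + lieGenL F L₁ L₂ y)
  | smul_left (c : F) (x : L₁) :
      LieFreeProductRel (lieGenL F L₁ L₂ (c • x)) (c • lieGenL F L₁ L₂ x)
  | lie_left (x y : L₁) :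
      LieFreeProductRel (lieGenL F L₁ L₂ ⁅x, y⁆) ⁅lieGenL F L₁ L₂ x, lieGenL F L₁ L₂ y⁆
  | add_right (x y : L₂) :
      LieFreeProductRel (lieGenR F L₁ L₂ (x + y)) (lieGenR F L₁ L₂ x + lieGenR F L₁ L₂ y)
  | smul_right (c : F) (x : L₂) :
      LieFreeProductRel (lieGenR F L₁ L₂ (c • x)) (c • lieGenR F L₁ L₂ x)
  | lie_right (x y : L₂) :
      LieFreeProductRel (lieGenR F L₁ L₂ ⁅x, y⁆) ⁅lieGenR F L₁ L₂ x, lieGenR F L₁ L₂ y⁆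

/-- The free product (coproduct) `L₁ * L₂` of two Lie algebras. -/
abbrev LieFreeProduct : Type (max u v w) := PresentedLie (LieFreeProductRel F L₁ L₂)

namespace LieFreeProduct

/-- The canonical homomorphism `L₁ → L₁ * L₂`. -/
def inl : L₁ →ₗ⁅F⁆ LieFreeProduct F L₁ L₂ where
  toFun x := PresentedLie.of _ (.inl x)
  map_add' x y := (PresentedLie.mk_eq (.add_left x y)).trans (map_add _ _ _)
  map_smul' c x := (PresentedLie.mk_eq (.smul_left c x)).trans (map_smul _ _ _)
  map_lie' {x y} := (PresentedLie.mk_eq (.lie_left x y)).trans (LieHom.map_lie _ _ _)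

/-- The canonical homomorphism `L₂ → L₁ * L₂`. -/
def inr : L₂ →ₗ⁅F⁆ LieFreeProduct F L₁ L₂ where
  toFun x := PresentedLie.of _ (.inr x)
  map_add' x y := (PresentedLie.mk_eq (.add_right x y)).trans (map_add _ _ _)
  map_smul' c x := (PresentedLie.mk_eq (.smul_right c x)).trans (map_smul _ _ _)
  map_lie' {x y} := (PresentedLie.mk_eq (.lie_right x y)).trans (LieHom.map_lie _ _ _)

variable {F L₁ L₂} {M : Type*} [LieRing M] [LieAlgebra F M]

/-- The homomorphism `L₁ * L₂ → M` with given restrictions to `L₁` and `L₂`. -/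
def lift (f : L₁ →ₗ⁅F⁆ M) (g : L₂ →ₗ⁅F⁆ M) : LieFreeProduct F L₁ L₂ →ₗ⁅F⁆ M :=
  PresentedLie.lift (Sum.elim f g) (by rintro _ _ (_ | _ | _ | _ | _ | _) <;> simp)

@[simp]
theorem lift_inl (f : L₁ →ₗ⁅F⁆ M) (g : L₂ →ₗ⁅F⁆ M) (x : L₁) :
    lift f g (inl F L₁ L₂ x) = f x :=
  PresentedLie.lift_of _ _ _

@[simp]
theorem lift_inr (f : L₁ →ₗ⁅F⁆ M) (g : L₂ →ₗ⁅F⁆ M) (x : L₂) :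
    lift f g (inr F L₁ L₂ x) = g x :=
  PresentedLie.lift_of _ _ _

theorem hom_ext {f g : LieFreeProduct F L₁ L₂ →ₗ⁅F⁆ M}
    (h₁ : ∀ x, f (inl F L₁ L₂ x) = g (inl F L₁ L₂ x))
    (h₂ : ∀ x, f (inr F L₁ L₂ x) = g (inr F L₁ L₂ x)) : f = g :=
  PresentedLie.hom_ext (by rintro (x | x); exacts [h₁ x, h₂ x])

/-- The canonical homomorphism `N₁ * N₂ → L₁ * L₂`, for ideals `N₁` of `L₁` and `N₂` of `L₂`. -/
def inclusion (N₁ : LieIdeal F L₁) (N₂ : LieIdeal F L₂) :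
    LieFreeProduct F N₁ N₂ →ₗ⁅F⁆ LieFreeProduct F L₁ L₂ :=
  lift ((inl F L₁ L₂).comp N₁.incl) ((inr F L₁ L₂).comp N₂.incl)

variable (F L₁ L₂) in
/-- The canonical epimorphism `L₁ * L₂ → L₁ ⊕ L₂`. -/
def toProd : LieFreeProduct F L₁ L₂ →ₗ⁅F⁆ L₁ × L₂ :=
  lift (LieHom.inl F L₁ L₂) (LieHom.inr F L₁ L₂)

end LieFreeProduct

variable {F L₁ L₂}

/-- The ideal `N₁ ⊕ N₂` of `L₁ ⊕ L₂`. -/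
def lieIdealProd (N₁ : LieIdeal F L₁) (N₂ : LieIdeal F L₂) : LieIdeal F (L₁ × L₂) :=
  { N₁.toSubmodule.prod N₂.toSubmodule with
    lie_mem := fun {_ _} h => ⟨N₁.lie_mem h.1, N₂.lie_mem h.2⟩ }

theorem LieFreeProduct.toProd_mem {N₁ : LieIdeal F L₁} {N₂ : LieIdeal F L₂}
    {N : LieIdeal F (LieFreeProduct F L₁ L₂)}
    (hN : N.toLieSubalgebra = (LieFreeProduct.inclusion N₁ N₂).range) :
    ∀ x ∈ N, LieFreeProduct.toProd F L₁ L₂ x ∈ lieIdealProd N₁ N₂ := by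
  intro x hx
  have hx' : x ∈ N.toLieSubalgebra := hx
  rw [hN] at hx'
  obtain ⟨y, rfl⟩ := hx'
  have key : (toProd F L₁ L₂).comp (inclusion N₁ N₂) =
      (lieIdealProd N₁ N₂).incl.comp (lift
        ⟨((LinearMap.inl F L₁ L₂) ∘ₗ N₁.toSubmodule.subtype).codRestrict
          (lieIdealProd N₁ N₂).toSubmodule (fun n => ⟨n.2, N₂.zero_mem⟩), by
            intro a b; apply Subtype.ext; exact Prod.ext rfl (lie_zero (0 : L₂)).symm⟩
        ⟨((LinearMap.inr F L₁ L₂) ∘ₗ N₂.toSubmodule.subtype).codRestrict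
          (lieIdealProd N₁ N₂).toSubmodule (fun n => ⟨N₁.zero_mem, n.2⟩), by
            intro a b; apply Subtype.ext; exact Prod.ext (lie_zero (0 : L₁)).symm rfl⟩) := by
    apply hom_ext
    · intro x
      simp [toProd, inclusion]
      rfl
    · intro x
      simp [toProd, inclusion]
      rfl
  have := LieHom.congr_fun key y
  change toProd F L₁ L₂ (inclusion N₁ N₂ y) ∈ _
  change toProd F L₁ L₂ (inclusion N₁ N₂ y) = _ at this
  rw [this]
  exact Subtype.property _

end FreeProduct

/-! ### The nonabelian tensor product -/

section Tensor

variable {F : Type u} [CommRing F]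
variable {L : Type v} [LieRing L] [LieAlgebra F L] {N : Type w} [LieRing N] [LieAlgebra F N]

open FreeLieAlgebra (of) in
/-- The defining relations of the nonabelian tensor product of two Lie algebras `L` and `N` which
act on each other by derivations; here `a l n` is `ˡn`, `b n l` is `ⁿl`, and the generator
`(l, n)` stands for `l ⊗ n`. -/
inductive LieTensorRel (a : L →ₗ⁅F⁆ LieDerivation F N N) (b : N →ₗ⁅F⁆ LieDerivation F L L) :
    FreeLieAlgebra F (L × N) → FreeLieAlgebra F (L × N) → Prop
  | smul_left (c : F) (l : L) (n : N) : LieTensorRel a b (of F (c • l, n)) (c • of F (l, n))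
  | smul_right (c : F) (l : L) (n : N) : LieTensorRel a b (of F (l, c • n)) (c • of F (l, n))
  | add_left (l l' : L) (n : N) : LieTensorRel a b (of F (l + l', n)) (of F (l, n) + of F (l', n))
  | add_right (l : L) (n n' : N) : LieTensorRel a b (of F (l, n + n')) (of F (l, n) + of F (l, n'))
  | lie_left (l l' : L) (n : N) :
      LieTensorRel a b (of F (⁅l, l'⁆, n)) (of F (l, a l' n) - of F (l', a l n))
  | lie_right (l : L) (n n' : N) :
      LieTensorRel a b (of F (l, ⁅n, n'⁆)) (of F (b n' l, n) - of F (b n l, n'))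
  | lie_lie (l l' : L) (n n' : N) :
      LieTensorRel a b ⁅of F (l, n), of F (l', n')⁆ (-of F (b n l, a l' n'))

/-- The nonabelian tensor product `L ⊗ N` with respect to the actions `a` of `L` on `N` and `b` of
`N` on `L`. -/
abbrev LieTensor (a : L →ₗ⁅F⁆ LieDerivation F N N) (b : N →ₗ⁅F⁆ LieDerivation F L L) :
    Type (max u v w) :=
  PresentedLie (LieTensorRel a b)

/-- The element `l ⊗ n`. -/
def LieTensor.tmul (a : L →ₗ⁅F⁆ LieDerivation F N N) (b : N →ₗ⁅F⁆ LieDerivation F L L)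
    (l : L) (n : N) : LieTensor a b :=
  PresentedLie.of _ (l, n)

namespace LieTensor

variable (a : L →ₗ⁅F⁆ LieDerivation F N N) (b : N →ₗ⁅F⁆ LieDerivation F L L)

theorem smul_tmul (c : F) (l : L) (n : N) : tmul a b (c • l) n = c • tmul a b l n :=
  (PresentedLie.mk_eq (LieTensorRel.smul_left c l n)).trans (map_smul _ _ _)

theorem tmul_smul (c : F) (l : L) (n : N) : tmul a b l (c • n) = c • tmul a b l n :=
  (PresentedLie.mk_eq (LieTensorRel.smul_right c l n)).trans (map_smul _ _ _)

theorem add_tmul (l l' : L) (n : N) : tmul a b (l + l') n = tmul a b l n + tmul a b l' n :=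
  (PresentedLie.mk_eq (LieTensorRel.add_left l l' n)).trans (map_add _ _ _)

theorem tmul_add (l : L) (n n' : N) : tmul a b l (n + n') = tmul a b l n + tmul a b l n' :=
  (PresentedLie.mk_eq (LieTensorRel.add_right l n n')).trans (map_add _ _ _)

theorem lie_tmul (l l' : L) (n : N) :
    tmul a b ⁅l, l'⁆ n = tmul a b l (a l' n) - tmul a b l' (a l n) :=
  (PresentedLie.mk_eq (LieTensorRel.lie_left l l' n)).trans (map_sub _ _ _)

theorem tmul_lie (l : L) (n n' : N) :
    tmul a b l ⁅n, n'⁆ = tmul a b (b n' l) n - tmul a b (b n l) n' :=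
  (PresentedLie.mk_eq (LieTensorRel.lie_right l n n')).trans (map_sub _ _ _)

theorem lie_tmul_tmul (l l' : L) (n n' : N) :
    ⁅tmul a b l n, tmul a b l' n'⁆ = -tmul a b (b n l) (a l' n') :=
  ((LieHom.map_lie _ _ _).symm.trans (PresentedLie.mk_eq (LieTensorRel.lie_lie l l' n n'))).trans
    (map_neg _ _)

end LieTensor

end Tensor

/-! ### The nonabelian tensor product of a pair, and `J₂` -/

section Pair

variable {F : Type u} [CommRing F]
variable {L : Type v} [LieRing L] [LieAlgebra F L] {L' : Type w} [LieRing L'] [LieAlgebra F L']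

/-- The action of `L` on its ideal `N` by Lie multiplication, `ˡn = [l, n]`. -/
def LieIdeal.actLeft (N : LieIdeal F L) : L →ₗ⁅F⁆ LieDerivation F N N where
  toFun l :=
    { toFun := fun n => ⁅l, n⁆
      map_add' := fun x y => lie_add l x y
      map_smul' := fun c x => lie_smul c l x
      leibniz' := fun x y => by
        apply Subtype.ext
        change ⁅l, ⁅(x : L), (y : L)⁆⁆ = ⁅(x : L), ⁅l, (y : L)⁆⁆ - ⁅(y : L), ⁅l, (x : L)⁆⁆
        rw [leibniz_lie, ← lie_skew (y : L) ⁅l, (x : L)⁆]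
        abel }
  map_add' l l' := by ext n; exact congrArg Subtype.val (add_lie l l' n)
  map_smul' c l := by ext n; exact congrArg Subtype.val (smul_lie c l n)
  map_lie' {l l'} := by ext n; exact congrArg Subtype.val (lie_lie l l' n)

/-- The action of the ideal `N` on `L` by Lie multiplication, `ⁿl = [n, l]`. -/
def LieIdeal.actRight (N : LieIdeal F L) : N →ₗ⁅F⁆ LieDerivation F L L :=
  (LieDerivation.ad F L).comp N.incl

@[simp]
theorem LieIdeal.coe_actLeft (N : LieIdeal F L) (l : L) (n : N) :
    (N.actLeft l n : L) = ⁅l, (n : L)⁆ := rfl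

@[simp]
theorem LieIdeal.actRight_apply (N : LieIdeal F L) (l : L) (n : N) :
    N.actRight n l = ⁅(n : L), l⁆ := LieDerivation.ad_apply_apply F L n l

/-- The nonabelian tensor product `L ⊗ N` of a Lie algebra `L` and its ideal `N`. -/
abbrev LiePairTensor (N : LieIdeal F L) : Type (max u v) := LieTensor N.actLeft N.actRight

namespace LiePairTensor

/-- The commutator map `κ : L ⊗ N → L`, `l ⊗ n ↦ [l, n]`; its image is `[L, N]`. -/
def kappa (N : LieIdeal F L) : LiePairTensor N →ₗ⁅F⁆ L :=
  PresentedLie.lift (fun p => ⁅p.1, (p.2 : L)⁆) (by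
    rintro _ _ (_ | _ | _ | _ | ⟨l, l', n⟩ | ⟨l, n, n'⟩ | ⟨l, l', n, n'⟩)
    · simp
    · simp
    · simp
    · simp
    · simp only [FreeLieAlgebra.lift_of_apply, map_sub]
      exact lie_lie l l' (n : L)
    · simp only [FreeLieAlgebra.lift_of_apply, map_sub]
      rw [LieIdeal.actRight_apply, LieIdeal.actRight_apply]
      change ⁅l, ⁅(n : L), (n' : L)⁆⁆ = ⁅⁅(n' : L), l⁆, (n : L)⁆ - ⁅⁅(n : L), l⁆, (n' : L)⁆
      rw [leibniz_lie, ← lie_skew (n : L) ⁅l, (n' : L)⁆, ← lie_skew l (n : L),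
        ← lie_skew l (n' : L)]
      simp only [neg_lie, neg_neg]
      abel
    · simp only [FreeLieAlgebra.lift_of_apply, map_neg, LieHom.map_lie]
      rw [LieIdeal.actRight_apply, LieIdeal.coe_actLeft]
      change ⁅⁅l, (n : L)⁆, ⁅l', (n' : L)⁆⁆ = -⁅⁅(n : L), l⁆, ⁅l', (n' : L)⁆⁆
      rw [← lie_skew l (n : L), neg_lie])

@[simp]
theorem kappa_tmul (N : LieIdeal F L) (l : L) (n : N) :
    kappa N (LieTensor.tmul _ _ l n) = ⁅l, (n : L)⁆ :=
  PresentedLie.lift_of _ _ _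

/-- The homomorphism `L ⊗ N → L' ⊗ N'`, `l ⊗ n ↦ f l ⊗ f n`, induced by a homomorphism
`f : L → L'` with `f N ⊆ N'`. -/
def map {N : LieIdeal F L} {N' : LieIdeal F L'} (f : L →ₗ⁅F⁆ L') (h : ∀ x ∈ N, f x ∈ N') :
    LiePairTensor N →ₗ⁅F⁆ LiePairTensor N' :=
  PresentedLie.lift (fun p => LieTensor.tmul _ _ (f p.1) ⟨f p.2, h _ p.2.2⟩) (by
    have hl (l : L) (n : N) : (⟨f (N.actLeft l n), h _ (N.actLeft l n).2⟩ : N') =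
        N'.actLeft (f l) ⟨f n, h _ n.2⟩ := Subtype.ext (f.map_lie l (n : L))
    have hr (l : L) (n : N) : f (N.actRight n l) = N'.actRight ⟨f n, h _ n.2⟩ (f l) := by
      rw [LieIdeal.actRight_apply, LieIdeal.actRight_apply]
      exact f.map_lie (n : L) l
    rintro _ _ (⟨c, l, n⟩ | ⟨c, l, n⟩ | ⟨l, l', n⟩ | ⟨l, n, n'⟩ | ⟨l, l', n⟩ | ⟨l, n, n'⟩ |
      ⟨l, l', n, n'⟩)
    · simp only [FreeLieAlgebra.lift_of_apply, map_smul, LieTensor.smul_tmul]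
    · simp only [FreeLieAlgebra.lift_of_apply, map_smul]
      rw [← LieTensor.tmul_smul]
      exact congrArg (LieTensor.tmul _ _ (f l)) (Subtype.ext (map_smul f c (n : L)))
    · simp only [FreeLieAlgebra.lift_of_apply, map_add, LieTensor.add_tmul]
    · simp only [FreeLieAlgebra.lift_of_apply, map_add]
      rw [← LieTensor.tmul_add]
      exact congrArg (LieTensor.tmul _ _ (f l)) (Subtype.ext (map_add f (n : L) (n' : L)))
    · simp only [FreeLieAlgebra.lift_of_apply, map_sub, hl, LieHom.map_lie, LieTensor.lie_tmul]
    · simp only [FreeLieAlgebra.lift_of_apply, map_sub, hr]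
      rw [← LieTensor.tmul_lie]
      exact congrArg (LieTensor.tmul _ _ (f l)) (Subtype.ext (f.map_lie (n : L) (n' : L)))
    · simp only [FreeLieAlgebra.lift_of_apply, map_neg, LieHom.map_lie, hl, hr,
        LieTensor.lie_tmul_tmul])

@[simp]
theorem map_tmul {N : LieIdeal F L} {N' : LieIdeal F L'} (f : L →ₗ⁅F⁆ L')
    (h : ∀ x ∈ N, f x ∈ N') (l : L) (n : N) :
    map f h (LieTensor.tmul _ _ l n) = LieTensor.tmul _ _ (f l) ⟨f n, h _ n.2⟩ :=
  PresentedLie.lift_of _ _ _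

theorem kappa_map {N : LieIdeal F L} {N' : LieIdeal F L'} (f : L →ₗ⁅F⁆ L')
    (h : ∀ x ∈ N, f x ∈ N') (t : LiePairTensor N) : kappa N' (map f h t) = f (kappa N t) := by
  have : (kappa N').comp (map f h) = f.comp (kappa N) := by
    apply PresentedLie.hom_ext
    rintro ⟨l, n⟩
    change kappa N' (map f h (LieTensor.tmul _ _ l n)) = f (kappa N (LieTensor.tmul _ _ l n))
    simp
  exact LieHom.congr_fun this t

end LiePairTensor

/-- `J₂(L, N)`, the kernel of the commutator map `κ : L ⊗ N → [L, N]`. -/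
abbrev lieJ2 (N : LieIdeal F L) : LieIdeal F (LiePairTensor N) := (LiePairTensor.kappa N).ker

/-- The homomorphism `J₂(L, N) → J₂(L', N')` induced by `f : L → L'` with `f N ⊆ N'`. -/
def lieJ2Map {N : LieIdeal F L} {N' : LieIdeal F L'} (f : L →ₗ⁅F⁆ L') (h : ∀ x ∈ N, f x ∈ N') :
    lieJ2 N →ₗ⁅F⁆ lieJ2 N' where
  toFun t := ⟨LiePairTensor.map f h t, by
    rw [LieHom.mem_ker, LiePairTensor.kappa_map, LieHom.mem_ker.1 t.2, map_zero]⟩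
  map_add' _ _ := Subtype.ext (map_add _ _ _)
  map_smul' _ _ := Subtype.ext (map_smul _ _ _)
  map_lie' := Subtype.ext (LieHom.map_lie _ _ _)

/-- The canonical homomorphism `J₂(L₁ * L₂, N₁ * N₂) → J₂(L₁ ⊕ L₂, N₁ ⊕ N₂)`, induced by the
canonical epimorphism `L₁ * L₂ → L₁ ⊕ L₂`, where `N₁ * N₂` is an ideal `N` of `L₁ * L₂`. -/
def lieJ2ToProd {N₁ : LieIdeal F L} {N₂ : LieIdeal F L'} {N : LieIdeal F (LieFreeProduct F L L')}
    (hN : N.toLieSubalgebra = (LieFreeProduct.inclusion N₁ N₂).range) :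
    lieJ2 N →ₗ⁅F⁆ lieJ2 (lieIdealProd N₁ N₂) :=
  lieJ2Map (LieFreeProduct.toProd F L L') (LieFreeProduct.toProd_mem hN)

/-- The Lie algebra `N / [N, L]`. -/
abbrev LieIdeal.modLie (N : LieIdeal F L) : Type v :=
  N ⧸ LieIdeal.comap N.incl ⁅N, (⊤ : LieIdeal F L)⁆

end Pair

end

/-!
By the Poincaré–Birkhoff–Witt theorem, `[x, y] ≠ 0` in `L₁ * L₂` for all nonzero `x ∈ L₁` and
`y ∈ L₂`: such a commutator acts nontrivially in an affine representation of `L₁ * L₂` on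
`U(L₁) ⊗ U(L₂)`. If `0 ≠ x ∈ N₁`, then `[x, y] ∈ N₁ * N₂` for all `y ∈ L₂`, and passing to
`L₁ * (L₂ / N₂)` gives `N₂ = L₂`; likewise `N₂ ≠ 0` forces `N₁ = L₁`. Hence either
`N₁ = L₁` and `N₂ = L₂`, or `N₁ = N₂ = 0`, or one of `L₁`, `L₂` is zero. In the last two cases the
map on `J₂` is bijective and `N₁ / [N₁, L₁] ⊗ N₂ / [N₂, L₂] = 0`.

For the tensor squares, `(L₁ ⊕ L₂) ⊗ (L₁ ⊕ L₂)` splits into `L₁ ⊗ L₁`, `L₂ ⊗ L₂` and the two mixed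
parts `L₁ᵃᵇ ⊗ L₂ᵃᵇ` and `L₂ᵃᵇ ⊗ L₁ᵃᵇ`. A linear map on the tensor square of `L₁ * L₂` which kills
the squares of `L₁` and `L₂` and all `x ⊗ y + y ⊗ x` with `x ∈ L₁`, `y ∈ L₂` is a 2-cocycle of
`L₁ * L₂`. The central extension it defines splits, because it splits over `L₁` and over `L₂`, so
the map factors through the bracket. Therefore each element of `J₂(L₁ * L₂)` is a sum of images of
the tensor squares of `L₁` and `L₂` and of symmetrized elements, and it is determined by its image
in `(L₁ ⊕ L₂) ⊗ (L₁ ⊕ L₂)`, whose two mixed parts agree up to the flip. The difference of the mixed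
parts identifies the cokernel of the map on `J₂` with `L₁ᵃᵇ ⊗ L₂ᵃᵇ`.
-/

noncomputable section

/-! ### The Poincaré–Birkhoff–Witt theorem -/

section Curvature

variable {R L M : Type*} [CommRing R] [LieRing L] [LieAlgebra R L] [AddCommGroup M] [Module R M]

/-- The curvature of a linear map `ρ : L → End M`: the obstruction to `ρ` being a representation. -/
def curvature (ρ : L →ₗ[R] Module.End R M) : L →ₗ[R] L →ₗ[R] Module.End R M :=
  LinearMap.mk₂ R (fun x y => ρ x * ρ y - ρ y * ρ x - ρ ⁅x, y⁆)
    (fun _ _ _ => by simp only [map_add, add_mul, mul_add, add_lie]; abel)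
    (fun _ _ _ => by simp only [map_smul, smul_lie, smul_mul_assoc, mul_smul_comm, smul_sub])
    (fun _ _ _ => by simp only [map_add, add_mul, mul_add, lie_add]; abel)
    (fun _ _ _ => by simp only [map_smul, lie_smul, smul_mul_assoc, mul_smul_comm, smul_sub])

theorem curvature_apply (ρ : L →ₗ[R] Module.End R M) (x y : L) (v : M) :
    curvature ρ x y v = ρ x (ρ y v) - ρ y (ρ x v) - ρ ⁅x, y⁆ v := rfl

theorem curvature_isAlt (ρ : L →ₗ[R] Module.End R M) : (curvature ρ).IsAlt := fun x =>
  LinearMap.ext fun v => by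
    rw [curvature_apply, lie_self, map_zero, sub_self, zero_sub, LinearMap.zero_apply, neg_zero]

theorem curvature_swap (ρ : L →ₗ[R] Module.End R M) (x y : L) (v : M) :
    curvature ρ x y v = -curvature ρ y x v :=
  LinearMap.congr_fun ((curvature_isAlt ρ).neg y x).symm v

theorem curvature_bianchi (ρ : L →ₗ[R] Module.End R M) (x y z : L) (v : M) :
    ρ x (curvature ρ y z v) + ρ y (curvature ρ z x v) + ρ z (curvature ρ x y v) +
      (curvature ρ x ⁅y, z⁆ v + curvature ρ y ⁅z, x⁆ v + curvature ρ z ⁅x, y⁆ v) =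
    curvature ρ y z (ρ x v) + curvature ρ z x (ρ y v) + curvature ρ x y (ρ z v) := by
  have jacobi : ρ ⁅x, ⁅y, z⁆⁆ v + ρ ⁅y, ⁅z, x⁆⁆ v + ρ ⁅z, ⁅x, y⁆⁆ v = 0 := by
    rw [← LinearMap.add_apply, ← LinearMap.add_apply, ← map_add, ← map_add, lie_jacobi, map_zero,
      LinearMap.zero_apply]
  simp only [curvature_apply, map_sub]
  linear_combination (norm := abel) -jacobi

end Curvature

section PBW

attribute [local instance] LieRing.ofAssociativeRing

variable {R L ι : Type*} [CommRing R]

variable (R ι) in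
/-- The polynomials of degree less than `d` in variables indexed by `ι`, where a monomial is given
by the multiset of its factors. -/
def degreeLT (d : ℕ) : Submodule R (Multiset ι →₀ R) :=
  Finsupp.supported R R {m | m.card < d}

theorem degreeLT_le_iff {d : ℕ} {p : Submodule R (Multiset ι →₀ R)} :
    degreeLT R ι d ≤ p ↔ ∀ m : Multiset ι, m.card < d → Finsupp.single m 1 ∈ p := by
  rw [degreeLT, Finsupp.supported_eq_span_single, Submodule.span_le, Set.image_subset_iff]
  rfl

theorem linearCombination_truncate {M : Type*} [AddCommGroup M] [Module R M]
    (f : Multiset ι → M) (d : ℕ) {v : Multiset ι →₀ R} (hv : v ∈ degreeLT R ι d) :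
    Finsupp.linearCombination R (fun k => if k.card < d then f k else 0) v =
      Finsupp.linearCombination R f v := by
  have : degreeLT R ι d ≤ LinearMap.eqLocus
      (Finsupp.linearCombination R fun k => if k.card < d then f k else 0)
      (Finsupp.linearCombination R f) :=
    degreeLT_le_iff.2 fun m hm => by simp [hm]
  exact this hv

theorem single_mem_degreeLT {m : Multiset ι} {d : ℕ} (h : m.card < d) :
    Finsupp.single m 1 ∈ degreeLT R ι d := Finsupp.single_mem_supported R 1 h

variable [LieRing L] [LieAlgebra R L] [LinearOrder ι]

theorem eq_zero_of_isAlt_of_basis (b : Module.Basis ι R L) {M : Type*} [AddCommGroup M]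
    [Module R M] {B : L →ₗ[R] L →ₗ[R] M} (hB : B.IsAlt)
    (h : ∀ i j, j < i → B (b i) (b j) = 0) : B = 0 := by
  refine b.ext fun i => b.ext fun j => ?_
  rcases lt_trichotomy i j with hij | rfl | hij
  · rw [← hB.neg, h j i hij, neg_zero]; rfl
  · exact hB _
  · exact h i j hij

variable (b : Module.Basis ι R L)

/-- The action of `x : L` on the monomial `m`, determined by letting `b i` act as multiplication
by `i` when `i` is at most the least factor `j` of `m`, and by `bᵢ bⱼ n = bⱼ bᵢ n + [bᵢ, bⱼ] n`
when `m = j n` with `j < i`. Here `T x` is the action of `x` on polynomials of degree less than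
that of `m`, and `bⱼ bᵢ n` is split up so that `T` only acts on such polynomials. -/
def pbwMul (m : Multiset ι) : L →ₗ[R] Multiset ι →₀ R :=
  let T (x : L) : (Multiset ι →₀ R) →ₗ[R] Multiset ι →₀ R :=
    Finsupp.linearCombination R fun k => if _ : k.card < m.card then pbwMul k x else 0
  b.constr R fun i => match m.sort (· ≤ ·) with
    | [] => .single {i} 1
    | j :: n => if i ≤ j then .single (i ::ₘ m) 1 else
      .single (i ::ₘ m) 1 + T (b j) (T (b i) (.single (n : Multiset ι) 1) - .single (i ::ₘ n) 1) +
        T ⁅b i, b j⁆ (.single (n : Multiset ι) 1)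
termination_by m.card

/-- The linear map `L → End (R[ι])` with values `pbwMul` on monomials. -/
def pbwAction : L →ₗ[R] Module.End R (Multiset ι →₀ R) :=
  (Finsupp.linearCombination R (pbwMul b)).flip

theorem pbwAction_single (x : L) (m : Multiset ι) :
    pbwAction b x (.single m 1) = pbwMul b m x := by
  simp [pbwAction]

theorem pbwAction_single_of_forall_le {i : ι} {m : Multiset ι} (h : ∀ k ∈ m, i ≤ k) :
    pbwAction b (b i) (.single m 1) = .single (i ::ₘ m) 1 := by
  rw [pbwAction_single, pbwMul, b.constr_basis]
  rcases hm : m.sort (· ≤ ·) with _ | ⟨j, n⟩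
  · rw [← m.sort_eq (· ≤ ·), hm]; rfl
  · have hj : j ∈ m := by rw [← Multiset.mem_sort (· ≤ ·), hm]; exact List.mem_cons_self
    exact if_pos (h j hj)

theorem pbwAction_single_cons_of_mem {i j : ι} {n : Multiset ι} (hji : j < i) (hjn : ∀ k ∈ n, j ≤ k)
    (hn : pbwAction b (b i) (.single n 1) - .single (i ::ₘ n) 1 ∈ degreeLT R ι (n.card + 1)) :
    pbwAction b (b i) (.single (j ::ₘ n) 1) =
      .single (i ::ₘ j ::ₘ n) 1 +
        pbwAction b (b j) (pbwAction b (b i) (.single n 1) - .single (i ::ₘ n) 1) +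
        pbwAction b ⁅b i, b j⁆ (.single n 1) := by
  have hT (x : L) {v : Multiset ι →₀ R} (hv : v ∈ degreeLT R ι (n.card + 1)) :
      Finsupp.linearCombination R
        (fun k => if k.card < (j ::ₘ n).card then pbwMul b k x else 0) v = pbwAction b x v := by
    rw [Multiset.card_cons, linearCombination_truncate (fun k => pbwMul b k x) _ hv]
    simp [pbwAction, Finsupp.linearCombination_apply, LinearMap.finsupp_sum_apply]
  rw [pbwAction_single, pbwMul, b.constr_basis, Multiset.sort_cons (r := (· ≤ ·)) j n hjn]
  simp only [Multiset.sort_eq, dite_eq_ite, if_neg hji.not_ge]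
  rw [hT (b i) (single_mem_degreeLT n.card.lt_succ_self), hT _ hn,
    hT _ (single_mem_degreeLT n.card.lt_succ_self)]

theorem pbwAction_mem_degreeLT_of_basis {d : ℕ}
    (hd : ∀ i m, m.card < d → pbwAction b (b i) (.single m 1) - .single (i ::ₘ m) 1 ∈
      degreeLT R ι (m.card + 1)) (x : L) {v : Multiset ι →₀ R} (hv : v ∈ degreeLT R ι d) :
    pbwAction b x v ∈ degreeLT R ι (d + 1) := by
  have hmono : ∀ {m : Multiset ι}, m.card < d → degreeLT R ι (m.card + 1) ≤ degreeLT R ι (d + 1) :=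
    fun h => degreeLT_le_iff.2 fun k hk => single_mem_degreeLT (by omega)
  have hbasis (m : Multiset ι) (hm : m.card < d) :
      ⊤ ≤ (degreeLT R ι (d + 1)).comap ((pbwAction b).flip (.single m 1)) := by
    rw [← b.span_eq, Submodule.span_le]
    rintro _ ⟨i, rfl⟩
    have := Submodule.add_mem _ (hmono hm (hd i m hm))
      (single_mem_degreeLT (m := i ::ₘ m) (by simpa using hm))
    rwa [sub_add_cancel] at this
  have : degreeLT R ι d ≤ (degreeLT R ι (d + 1)).comap (pbwAction b x) :=
    degreeLT_le_iff.2 fun m hm => hbasis m hm Submodule.mem_top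
  exact this hv

theorem forall_le_or_exists_eq_cons (i : ι) (m : Multiset ι) :
    (∀ k ∈ m, i ≤ k) ∨ ∃ j n, m = j ::ₘ n ∧ j < i ∧ ∀ k ∈ n, j ≤ k := by
  by_cases h : ∀ k ∈ m, i ≤ k
  · exact .inl h
  push Not at h
  obtain ⟨k, hk, hki⟩ := h
  obtain ⟨j, hj, hmin⟩ := m.toFinset.exists_minimal ⟨k, by simpa using hk⟩
  have hle : ∀ l ∈ m, j ≤ l := fun l hl =>
    le_of_not_gt fun hlj => hlj.not_ge (hmin (by simpa using hl) hlj.le)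
  obtain ⟨n, rfl⟩ := Multiset.exists_cons_of_mem (Multiset.mem_toFinset.1 hj)
  exact .inr ⟨j, n, rfl, (hle k hk).trans_lt hki, fun l hl => hle l (Multiset.mem_cons_of_mem hl)⟩

theorem pbwAction_sub_mem_degreeLT (i : ι) (m : Multiset ι) :
    pbwAction b (b i) (.single m 1) - .single (i ::ₘ m) 1 ∈ degreeLT R ι (m.card + 1) := by
  induction hm : m.card using Nat.strong_induction_on generalizing i m with | _ d ih
  subst hm
  rcases forall_le_or_exists_eq_cons i m with h | ⟨j, n, rfl, hji, hjn⟩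
  · rw [pbwAction_single_of_forall_le b h, sub_self]
    exact Submodule.zero_mem _
  rw [Multiset.card_cons] at ih ⊢
  have hstep := pbwAction_mem_degreeLT_of_basis b fun k l hl => ih l.card hl k l rfl
  have hn := ih n.card n.card.lt_succ_self i n rfl
  rw [pbwAction_single_cons_of_mem b hji hjn hn, add_assoc (Finsupp.single _ _),
    add_sub_cancel_left]
  exact Submodule.add_mem _ (hstep _ hn) (hstep _ (single_mem_degreeLT n.card.lt_succ_self))

theorem pbwAction_single_cons {i j : ι} {n : Multiset ι} (hji : j < i) (hjn : ∀ k ∈ n, j ≤ k) :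
    pbwAction b (b i) (.single (j ::ₘ n) 1) =
      .single (i ::ₘ j ::ₘ n) 1 +
        pbwAction b (b j) (pbwAction b (b i) (.single n 1) - .single (i ::ₘ n) 1) +
        pbwAction b ⁅b i, b j⁆ (.single n 1) :=
  pbwAction_single_cons_of_mem b hji hjn (pbwAction_sub_mem_degreeLT b i n)

theorem curvature_pbwAction_single_of_forall_le {i j : ι} {m : Multiset ι} (hji : j < i)
    (hjm : ∀ k ∈ m, j ≤ k) : curvature (pbwAction b) (b i) (b j) (.single m 1) = 0 := by
  have hj : pbwAction b (b j) (.single (i ::ₘ m) 1) = .single (i ::ₘ j ::ₘ m) 1 := by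
    rw [pbwAction_single_of_forall_le b (by simpa using ⟨hji.le, hjm⟩), Multiset.cons_swap]
  rw [curvature_apply, pbwAction_single_of_forall_le b hjm, pbwAction_single_cons b hji hjm,
    map_sub, hj]
  abel

theorem curvature_pbwAction_eq_zero_of_mem {d : ℕ}
    (hd : ∀ x y m, m.card < d → curvature (pbwAction b) x y (.single m 1) = 0) (x y : L)
    {v : Multiset ι →₀ R} (hv : v ∈ degreeLT R ι d) : curvature (pbwAction b) x y v = 0 :=
  (degreeLT_le_iff (p := LinearMap.ker (curvature (pbwAction b) x y))).2 (hd x y) hv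

theorem curvature_pbwAction_basis_single (d : ℕ)
    (hd : ∀ x y m, m.card < d → curvature (pbwAction b) x y (.single m 1) = 0)
    {i j : ι} {m : Multiset ι} (hji : j < i) (hm : m.card = d) :
    curvature (pbwAction b) (b i) (b j) (.single m 1) = 0 := by
  set ρ := pbwAction b
  rcases forall_le_or_exists_eq_cons j m with h | ⟨k, n, rfl, hkj, hkn⟩
  · exact curvature_pbwAction_single_of_forall_le b hji h
  rw [Multiset.card_cons] at hm
  have hn (x y : L) : curvature ρ x y (.single n 1) = 0 := hd x y n (by omega)
  have hcomm {p q : ι} (hkp : k < p) (hkq : k < q) :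
      curvature ρ (b q) (b k) (ρ (b p) (.single n 1)) = 0 := by
    rw [← sub_add_cancel (ρ (b p) (.single n 1)) (.single (p ::ₘ n) 1), map_add,
      curvature_pbwAction_eq_zero_of_mem b hd _ _ (hm ▸ pbwAction_sub_mem_degreeLT b p n),
      curvature_pbwAction_single_of_forall_le b hkq (by simpa using ⟨hkp.le, hkn⟩), zero_add]
  -- As `bₖ n = k n`, the curvature at `k n` is a term of the Bianchi identity at `n`; the others
  -- vanish by induction on the degree, or because `bₖ` merely multiplies `bᵢ n` and `bⱼ n` by `k`.
  have hbianchi := curvature_bianchi ρ (b i) (b j) (b k) (.single n 1)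
  simp only [hn, curvature_swap ρ (b k) (b i), hcomm hkj (hkj.trans hji), hcomm (hkj.trans hji) hkj,
    map_zero, neg_zero, add_zero, zero_add] at hbianchi
  rw [pbwAction_single_of_forall_le b hkn] at hbianchi
  exact hbianchi.symm

theorem curvature_pbwAction : curvature (pbwAction b) = 0 := by
  have key (m : Multiset ι) (x y : L) : curvature (pbwAction b) x y (.single m 1) = 0 := by
    induction hm : m.card using Nat.strong_induction_on generalizing x y m with | _ d ih
    let B : L →ₗ[R] L →ₗ[R] Multiset ι →₀ R :=
      (curvature (pbwAction b)).compr₂ (LinearMap.applyₗ (.single m 1))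
    have hB : B = 0 :=
      eq_zero_of_isAlt_of_basis b (fun x => by simp [B, curvature_isAlt _ x]) fun i j hji =>
        curvature_pbwAction_basis_single b d (fun x y m hm => ih _ hm m x y rfl) hji hm
    exact LinearMap.congr_fun₂ hB x y
  exact LinearMap.ext₂ fun x y => Finsupp.lhom_ext' fun m => LinearMap.ext_ring (key m x y)

/-- The representation of `L` on its symmetric algebra, written as polynomials in a basis. -/
def pbwRepresentation : L →ₗ⁅R⁆ Module.End R (Multiset ι →₀ R) :=
  { pbwAction b with
    map_lie' {x y} := (sub_eq_zero.1 (LinearMap.congr_fun₂ (curvature_pbwAction b) x y)).symm }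

theorem universalEnvelopingAlgebra_ι_injective [Module.Free R L] :
    Function.Injective (UniversalEnvelopingAlgebra.ι R (L := L)) := by
  classical
  let b := Module.Free.chooseBasis R L
  let : LinearOrder (Module.Free.ChooseBasisIndex R L) := linearOrderOfSTO WellOrderingRel
  let π := Finsupp.linearCombination R fun m : Multiset _ => (m.map b).sum
  have hπ : π ∘ₗ (pbwAction b).flip (.single 0 1) = .id := b.ext fun i => by
    simp [π, pbwAction_single_of_forall_le b (i := i) (m := 0)]
  refine Function.LeftInverse.injective
    (g := fun u => π (UniversalEnvelopingAlgebra.lift R (pbwRepresentation b) u (.single 0 1)))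
    fun x => ?_
  simp only [UniversalEnvelopingAlgebra.lift_ι_apply]
  exact LinearMap.congr_fun hπ x

end PBW

/-! ### Commutators in a free product -/

section AffineRepresentation

attribute [local instance] LieRing.ofAssociativeRing

variable {F L A : Type*} [CommRing F] [LieRing L] [LieAlgebra F L] [Ring A] [Algebra F A]

/-- The representation of `L` on `A × F` by affine transformations `w ↦ ρ x * (w + e)` of an
associative algebra `A`, where `w : A` is embedded as `(w, 1)`. -/
def affineRepresentation (ρ : L →ₗ⁅F⁆ A) (e : A) : L →ₗ⁅F⁆ Module.End F (A × F) where
  toFun x := LinearMap.inl F A F ∘ₗ LinearMap.mulLeft F (ρ x) ∘ₗ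
    (LinearMap.fst F A F + (LinearMap.snd F A F).smulRight e)
  map_add' x y := by ext <;> simp [add_mul]
  map_smul' c x := by ext <;> simp
  map_lie' {x y} := by ext <;> simp [LieRing.of_associative_ring_bracket, sub_mul, mul_assoc]

theorem affineRepresentation_apply (ρ : L →ₗ⁅F⁆ A) (e : A) (x : L) (w : A) (c : F) :
    affineRepresentation ρ e x (w, c) = (ρ x * (w + c • e), 0) := rfl

end AffineRepresentation

theorem tmul_ne_zero {F V W : Type*} [Field F] [AddCommGroup V] [Module F V] [AddCommGroup W]
    [Module F W] {v : V} {w : W} (hv : v ≠ 0) (hw : w ≠ 0) : v ⊗ₜ[F] w ≠ 0 := by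
  obtain ⟨f, hf⟩ := Module.Projective.exists_dual_ne_zero F hv
  obtain ⟨g, hg⟩ := Module.Projective.exists_dual_ne_zero F hw
  refine fun h => mul_ne_zero hf hg ?_
  rw [← smul_eq_mul, ← TensorProduct.lid_tmul, ← TensorProduct.map_tmul, h, map_zero, map_zero]

namespace PresentedLie

variable {F : Type u} [CommRing F] {X : Type v} {r : FreeLieAlgebra F X → FreeLieAlgebra F X → Prop}

theorem lieSpan_range_of : LieSubalgebra.lieSpan F (PresentedLie r) (Set.range (of r)) = ⊤ := by
  let S := LieSubalgebra.lieSpan F (PresentedLie r) (Set.range (of r))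
  let f : FreeLieAlgebra F X →ₗ⁅F⁆ S :=
    FreeLieAlgebra.lift F fun x => ⟨of r x, LieSubalgebra.subset_lieSpan ⟨x, rfl⟩⟩
  have hf : S.incl.comp f = mk r :=
    FreeLieAlgebra.hom_ext fun x => congrArg S.incl (FreeLieAlgebra.lift_of_apply _ x)
  refine eq_top_iff.2 fun z _ => ?_
  obtain ⟨z, rfl⟩ := mk_surjective z
  exact hf ▸ (f z).2

end PresentedLie

namespace LieFreeProduct

variable {F : Type u} [CommRing F] {L₁ : Type v} [LieRing L₁] [LieAlgebra F L₁]
  {L₂ : Type w} [LieRing L₂] [LieAlgebra F L₂]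

theorem eq_top_of_forall_mem {S : LieSubalgebra F (LieFreeProduct F L₁ L₂)}
    (h₁ : ∀ x, inl F L₁ L₂ x ∈ S) (h₂ : ∀ y, inr F L₁ L₂ y ∈ S) : S = ⊤ := by
  rw [eq_top_iff, ← PresentedLie.lieSpan_range_of, LieSubalgebra.lieSpan_le]
  rintro _ ⟨x | y, rfl⟩
  exacts [h₁ x, h₂ y]

theorem toProd_inl (x : L₁) : toProd F L₁ L₂ (inl F L₁ L₂ x) = (x, 0) := lift_inl _ _ x

theorem toProd_inr (y : L₂) : toProd F L₁ L₂ (inr F L₁ L₂ y) = (0, y) := lift_inr _ _ y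

theorem toProd_lie_inl_inr (x : L₁) (y : L₂) :
    toProd F L₁ L₂ ⁅inl F L₁ L₂ x, inr F L₁ L₂ y⁆ = 0 := by
  rw [LieHom.map_lie, toProd_inl, toProd_inr]
  exact Prod.ext (lie_zero x) (zero_lie y)

variable {N₁ : LieIdeal F L₁} {N₂ : LieIdeal F L₂} {N : LieIdeal F (LieFreeProduct F L₁ L₂)}

theorem inl_mem (hN : N.toLieSubalgebra = (inclusion N₁ N₂).range) {x : L₁} (hx : x ∈ N₁) :
    inl F L₁ L₂ x ∈ N :=
  hN.ge ⟨inl F N₁ N₂ ⟨x, hx⟩, lift_inl _ _ _⟩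

theorem inr_mem (hN : N.toLieSubalgebra = (inclusion N₁ N₂).range) {y : L₂} (hy : y ∈ N₂) :
    inr F L₁ L₂ y ∈ N :=
  hN.ge ⟨inr F N₁ N₂ ⟨y, hy⟩, lift_inr _ _ _⟩

theorem toLieSubalgebra_le (hN : N.toLieSubalgebra = (inclusion N₁ N₂).range)
    {S : LieSubalgebra F (LieFreeProduct F L₁ L₂)} (h₁ : ∀ x ∈ N₁, inl F L₁ L₂ x ∈ S)
    (h₂ : ∀ y ∈ N₂, inr F L₁ L₂ y ∈ S) : N.toLieSubalgebra ≤ S := by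
  have hS : S.comap (inclusion N₁ N₂) = ⊤ := eq_top_of_forall_mem
    (fun x => by simpa [inclusion] using h₁ x x.2) (fun y => by simpa [inclusion] using h₂ y y.2)
  rw [hN]
  rintro _ ⟨z, rfl⟩
  exact hS.ge (LieSubalgebra.mem_top z)

end LieFreeProduct

/-- The quotient map of a Lie algebra by an ideal, as a homomorphism of Lie algebras. -/
def lieQuotientMk {R L : Type*} [CommRing R] [LieRing L] [LieAlgebra R L] (I : LieIdeal R L) :
    L →ₗ⁅R⁆ L ⧸ I :=
  { (LieSubmodule.Quotient.mk' I : L →ₗ[R] L ⧸ I) with map_lie' := rfl }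

namespace LieFreeProduct

variable {F : Type u} [Field F] {L₁ : Type v} [LieRing L₁] [LieAlgebra F L₁]
  {L₂ : Type w} [LieRing L₂] [LieAlgebra F L₂]

section

attribute [local instance] LieRing.ofAssociativeRing

theorem lie_inl_inr_ne_zero {x : L₁} {y : L₂} (hx : x ≠ 0) (hy : y ≠ 0) :
    ⁅inl F L₁ L₂ x, inr F L₁ L₂ y⁆ ≠ 0 := by
  let U₁ := UniversalEnvelopingAlgebra F L₁
  let U₂ := UniversalEnvelopingAlgebra F L₂
  let ρ₁ : L₁ →ₗ⁅F⁆ U₁ ⊗[F] U₂ :=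
    (Algebra.TensorProduct.includeLeft : U₁ →ₐ[F] U₁ ⊗[F] U₂).toLieHom.comp
      (UniversalEnvelopingAlgebra.ι F)
  let ρ₂ : L₂ →ₗ⁅F⁆ U₁ ⊗[F] U₂ :=
    (Algebra.TensorProduct.includeRight : U₂ →ₐ[F] U₁ ⊗[F] U₂).toLieHom.comp
      (UniversalEnvelopingAlgebra.ι F)
  let ρ := lift (affineRepresentation ρ₁ 0) (affineRepresentation ρ₂ 1)
  have hρ : ρ ⁅inl F L₁ L₂ x, inr F L₁ L₂ y⁆ (0, 1) = (ρ₁ x * ρ₂ y, 0) := by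
    simp [ρ, LieRing.of_associative_ring_bracket, affineRepresentation_apply]
  have hmul : ρ₁ x * ρ₂ y = UniversalEnvelopingAlgebra.ι F x ⊗ₜ UniversalEnvelopingAlgebra.ι F y :=
    (Algebra.TensorProduct.tmul_mul_tmul _ 1 1 _).trans
      (congrArg₂ (· ⊗ₜ ·) (mul_one _) (one_mul _))
  intro h
  rw [h, map_zero, LinearMap.zero_apply, hmul] at hρ
  exact tmul_ne_zero ((map_ne_zero_iff _ universalEnvelopingAlgebra_ι_injective).2 hx)
    ((map_ne_zero_iff _ universalEnvelopingAlgebra_ι_injective).2 hy) (congrArg Prod.fst hρ).symm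

end

theorem lie_inl_inr_notMem_range_inl {x : L₁} {y : L₂} (hx : x ≠ 0) (hy : y ≠ 0) :
    ⁅inl F L₁ L₂ x, inr F L₁ L₂ y⁆ ∉ (inl F L₁ L₂).range := by
  rintro ⟨a, ha⟩
  have h : (a, (0 : L₂)) = 0 :=
    (toProd_inl (F := F) a).symm.trans ((congrArg _ ha).trans (toProd_lie_inl_inr x y))
  rw [(Prod.mk_eq_zero.1 h).1, map_zero] at ha
  exact lie_inl_inr_ne_zero hx hy ha.symm

theorem lie_inl_inr_notMem_range_inr {x : L₁} {y : L₂} (hx : x ≠ 0) (hy : y ≠ 0) :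
    ⁅inl F L₁ L₂ x, inr F L₁ L₂ y⁆ ∉ (inr F L₁ L₂).range := by
  rintro ⟨a, ha⟩
  have h : ((0 : L₁), a) = 0 :=
    (toProd_inr (F := F) a).symm.trans ((congrArg _ ha).trans (toProd_lie_inl_inr x y))
  rw [(Prod.mk_eq_zero.1 h).2, map_zero] at ha
  exact lie_inl_inr_ne_zero hx hy ha.symm

variable {N₁ : LieIdeal F L₁} {N₂ : LieIdeal F L₂} {N : LieIdeal F (LieFreeProduct F L₁ L₂)}

theorem left_eq_bot_or_right_eq_top (hN : N.toLieSubalgebra = (inclusion N₁ N₂).range) :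
    N₁ = ⊥ ∨ N₂ = ⊤ := by
  refine or_iff_not_imp_left.2 fun h₁ => eq_top_iff.2 fun y _ => ?_
  obtain ⟨x, hx, hx0⟩ := N₁.toSubmodule.ne_bot_iff.1 (mt (LieSubmodule.toSubmodule_eq_bot _).1 h₁)
  let π := lift (inl F L₁ (L₂ ⧸ N₂)) ((inr F L₁ (L₂ ⧸ N₂)).comp (lieQuotientMk N₂))
  have hπ : N.toLieSubalgebra ≤ (inl F L₁ (L₂ ⧸ N₂)).range.comap π := by
    refine toLieSubalgebra_le hN (fun a _ => ⟨a, (lift_inl _ _ a).symm⟩) fun b hb => ⟨0, ?_⟩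
    have hb0 : lieQuotientMk N₂ b = 0 := LieSubmodule.Quotient.mk_eq_zero'.2 hb
    simp [π, hb0]
  have hmem : ⁅inl F L₁ L₂ x, inr F L₁ L₂ y⁆ ∈ N := lie_mem_left F _ _ _ _ (inl_mem hN hx)
  by_contra hy
  have hy0 : lieQuotientMk N₂ y ≠ 0 := fun h => hy (LieSubmodule.Quotient.mk_eq_zero'.1 h)
  have hπmem : π ⁅inl F L₁ L₂ x, inr F L₁ L₂ y⁆ ∈ (inl F _ _).range := hπ hmem
  rw [LieHom.map_lie, lift_inl, lift_inr] at hπmem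
  exact lie_inl_inr_notMem_range_inl hx0 hy0 hπmem

theorem right_eq_bot_or_left_eq_top (hN : N.toLieSubalgebra = (inclusion N₁ N₂).range) :
    N₂ = ⊥ ∨ N₁ = ⊤ := by
  refine or_iff_not_imp_left.2 fun h₂ => eq_top_iff.2 fun x _ => ?_
  obtain ⟨y, hy, hy0⟩ := N₂.toSubmodule.ne_bot_iff.1 (mt (LieSubmodule.toSubmodule_eq_bot _).1 h₂)
  let π := lift ((inl F (L₁ ⧸ N₁) L₂).comp (lieQuotientMk N₁)) (inr F (L₁ ⧸ N₁) L₂)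
  have hπ : N.toLieSubalgebra ≤ (inr F (L₁ ⧸ N₁) L₂).range.comap π := by
    refine toLieSubalgebra_le hN (fun a ha => ⟨0, ?_⟩) fun b _ => ⟨b, (lift_inr _ _ b).symm⟩
    have ha0 : lieQuotientMk N₁ a = 0 := LieSubmodule.Quotient.mk_eq_zero'.2 ha
    simp [π, ha0]
  have hmem : ⁅inl F L₁ L₂ x, inr F L₁ L₂ y⁆ ∈ N := lie_mem_right F _ _ _ _ (inr_mem hN hy)
  by_contra hx
  have hx0 : lieQuotientMk N₁ x ≠ 0 := fun h => hx (LieSubmodule.Quotient.mk_eq_zero'.1 h)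
  have hπmem : π ⁅inl F L₁ L₂ x, inr F L₁ L₂ y⁆ ∈ (inr F _ _).range := hπ hmem
  rw [LieHom.map_lie, lift_inl, lift_inr] at hπmem
  exact lie_inl_inr_notMem_range_inr hx0 hy0 hπmem

end LieFreeProduct

/-! ### Nonabelian tensor products as modules -/

section Abelian

variable {F L M : Type*} [CommRing F] [LieRing L] [LieAlgebra F L] [LieRing M] [LieAlgebra F M]

theorem isLieAbelian_quotient [IsLieAbelian L] (I : LieIdeal F L) : IsLieAbelian (L ⧸ I) :=
  (show Function.Surjective (lieQuotientMk I) from Quot.mk_surjective).isLieAbelian ‹_›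

/-- A linear equivalence between abelian Lie algebras, as an equivalence of Lie algebras. -/
def lieEquivOfIsLieAbelian [IsLieAbelian L] [IsLieAbelian M] (e : L ≃ₗ[F] M) : L ≃ₗ⁅F⁆ M :=
  { e with map_lie' := by simp [trivial_lie_zero] }

theorem isIdealMorphism_of_isLieAbelian [IsLieAbelian M] (f : L →ₗ⁅F⁆ M) : f.IsIdealMorphism :=
  f.isIdealMorphism_iff.2 fun _ _ => ⟨0, by rw [trivial_lie_zero, map_zero]⟩

/-- An abelian group as a Lie ring with zero bracket. -/
abbrev zeroLieRing (V : Type*) [AddCommGroup V] : LieRing V where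
  bracket _ _ := 0
  add_lie _ _ _ := (add_zero 0).symm
  lie_add _ _ _ := (add_zero 0).symm
  lie_self _ := rfl
  leibniz_lie _ _ _ := (add_zero 0).symm

end Abelian

namespace LieTensor

variable {F : Type u} [CommRing F] {L : Type v} [LieRing L] [LieAlgebra F L]
  {N : Type w} [LieRing N] [LieAlgebra F N]
  (a : L →ₗ⁅F⁆ LieDerivation F N N) (b : N →ₗ⁅F⁆ LieDerivation F L L)

/-- The map `(l, n) ↦ l ⊗ n` as a bilinear map. -/
def tmulₗ : L →ₗ[F] N →ₗ[F] LieTensor a b :=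
  LinearMap.mk₂ F (tmul a b) (add_tmul a b) (smul_tmul a b) (tmul_add a b) (tmul_smul a b)

@[simp]
theorem tmulₗ_apply (l : L) (n : N) : tmulₗ a b l n = tmul a b l n := rfl

@[simp]
theorem zero_tmul (n : N) : tmul a b 0 n = 0 := LinearMap.map_zero₂ (tmulₗ a b) n

@[simp]
theorem tmul_zero (l : L) : tmul a b l 0 = 0 := map_zero (tmulₗ a b l)

theorem span_tmul_eq_top :
    Submodule.span F (Set.range fun p : L × N => tmul a b p.1 p.2) = ⊤ := by
  let S := Submodule.span F (Set.range fun p : L × N => tmul a b p.1 p.2)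
  have hS : ∀ s ∈ S, ∀ t ∈ S, ⁅s, t⁆ ∈ S := by
    refine fun s hs t ht => LinearMap.BilinMap.apply_apply_mem_of_mem_span S _ _
      (LieModule.toEnd F (LieTensor a b) (LieTensor a b) : _ →ₗ[F] _) ?_ s t hs ht
    rintro _ ⟨⟨l, n⟩, rfl⟩ _ ⟨⟨l', n'⟩, rfl⟩
    change ⁅tmul a b l n, tmul a b l' n'⁆ ∈ S
    exact lie_tmul_tmul a b l l' n n' ▸ S.neg_mem (Submodule.subset_span ⟨(_, _), rfl⟩)
  have hgen : (⊤ : LieSubalgebra F (LieTensor a b)) ≤ { S with lie_mem' := (hS _ · _ ·) } := by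
    rw [← PresentedLie.lieSpan_range_of, LieSubalgebra.lieSpan_le]
    exact Submodule.subset_span
  exact eq_top_iff.2 hgen

variable {a b} {V : Type*} [AddCommGroup V] [Module F V]

theorem linearMap_ext {f g : LieTensor a b →ₗ[F] V}
    (h : ∀ l n, f (tmul a b l n) = g (tmul a b l n)) : f = g :=
  LinearMap.ext_on_range (span_tmul_eq_top a b) fun p => h p.1 p.2

@[elab_as_elim]
theorem induction_on {p : LieTensor a b → Prop} (t : LieTensor a b)
    (tmul : ∀ l n, p (tmul a b l n)) (add : ∀ s t, p s → p t → p (s + t)) : p t := by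
  induction (span_tmul_eq_top a b).ge (Submodule.mem_top (x := t))
    using Submodule.closure_induction with
  | smul_mem c t h => obtain ⟨q, rfl⟩ := h; exact smul_tmul a b c q.1 q.2 ▸ tmul _ _
  | zero => exact zero_tmul a b 0 ▸ tmul 0 0
  | add s t _ _ hs ht => exact add s t hs ht

/-- The linear map on a nonabelian tensor product given by a bilinear map which respects the
defining relations when the target carries the zero bracket. -/
def liftLinear (β : L →ₗ[F] N →ₗ[F] V)
    (h₁ : ∀ l l' n, β ⁅l, l'⁆ n = β l (a l' n) - β l' (a l n))
    (h₂ : ∀ l n n', β l ⁅n, n'⁆ = β (b n' l) n - β (b n l) n')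
    (h₃ : ∀ l l' n n', β (b n l) (a l' n') = 0) : LieTensor a b →ₗ[F] V :=
  letI : LieRing V := zeroLieRing V
  letI : LieAlgebra F V := { ‹Module F V› with lie_smul := fun _ _ _ => (smul_zero _).symm }
  PresentedLie.lift (r := LieTensorRel a b) (M := V) (fun p => β p.1 p.2) (by
    rintro _ _ (⟨c, l, n⟩ | ⟨c, l, n⟩ | ⟨l, l', n⟩ | ⟨l, n, n'⟩ | ⟨l, l', n⟩ | ⟨l, n, n'⟩ |
      ⟨l, l', n, n'⟩)
    · simp
    · simp
    · simp
    · simp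
    · simp [h₁]
    · simp [h₂]
    · simp only [LieHom.map_lie, FreeLieAlgebra.lift_of_apply, map_neg, h₃, neg_zero]
      rfl)

@[simp]
theorem liftLinear_tmul (β : L →ₗ[F] N →ₗ[F] V)
    (h₁ : ∀ l l' n, β ⁅l, l'⁆ n = β l (a l' n) - β l' (a l n))
    (h₂ : ∀ l n n', β l ⁅n, n'⁆ = β (b n' l) n - β (b n l) n')
    (h₃ : ∀ l l' n n', β (b n l) (a l' n') = 0) (l : L) (n : N) :
    liftLinear β h₁ h₂ h₃ (tmul a b l n) = β l n :=
  letI : LieRing V := zeroLieRing V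
  letI : LieAlgebra F V := { ‹Module F V› with lie_smul := fun _ _ _ => (smul_zero _).symm }
  PresentedLie.lift_of (M := V) _ _ _

section TrivialActions

instance isLieAbelian_of_zero : IsLieAbelian
    (LieTensor (0 : L →ₗ⁅F⁆ LieDerivation F N N) (0 : N →ₗ⁅F⁆ LieDerivation F L L)) where
  trivial s t := by
    induction s using induction_on with
    | add s s' hs hs' => rw [add_lie, hs, hs', add_zero]
    | tmul l n =>
      induction t using induction_on with
      | add t t' ht ht' => rw [lie_add, ht, ht', add_zero]
      | tmul l' n' => exact (lie_tmul_tmul _ _ l l' n n').trans (by simp)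

variable (F L N) in
/-- The nonabelian tensor product of abelian Lie algebras acting trivially on each other is their
usual tensor product. -/
def equivTensorProduct [IsLieAbelian L] [IsLieAbelian N] :
    LieTensor (0 : L →ₗ⁅F⁆ LieDerivation F N N) (0 : N →ₗ⁅F⁆ LieDerivation F L L) ≃ₗ[F]
      L ⊗[F] N :=
  LinearEquiv.ofLinearMap
    (liftLinear (TensorProduct.mk F L N) (by simp [trivial_lie_zero])
      (by simp [trivial_lie_zero]) (by simp))
    (TensorProduct.lift (tmulₗ _ _))
    (TensorProduct.ext' fun x y => by simp)
    (linearMap_ext fun l n => by simp)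

end TrivialActions

end LieTensor

namespace LiePairTensor

open LieTensor

variable {F : Type u} [CommRing F] {L : Type v} [LieRing L] [LieAlgebra F L] {N : LieIdeal F L}

theorem kappa_mem (t : LiePairTensor N) : kappa N t ∈ N := by
  induction t using LieTensor.induction_on with
  | tmul l n => exact (kappa_tmul N l n).symm ▸ N.lie_mem n.2
  | add s t hs ht => exact (map_add (kappa N) s t).symm ▸ add_mem hs ht

theorem lie_eq_tmul (s t : LiePairTensor N) :
    ⁅s, t⁆ = tmul N.actLeft N.actRight (kappa N s) ⟨kappa N t, kappa_mem t⟩ := by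
  induction s using LieTensor.induction_on with
  | add s s' hs hs' => rw [add_lie, hs, hs', map_add, add_tmul]
  | tmul l n =>
    induction t using LieTensor.induction_on with
    | add t t' ht ht' =>
      rw [lie_add, ht, ht', ← tmul_add]
      exact congrArg _ (Subtype.ext (map_add (kappa N) t t').symm)
    | tmul l' n' =>
      rw [lie_tmul_tmul, LieIdeal.actRight_apply, kappa_tmul, ← lie_skew l (n : L),
        ← tmulₗ_apply, ← tmulₗ_apply, map_neg, LinearMap.neg_apply]
      exact congrArg (fun n => -tmulₗ _ _ _ n) (Subtype.ext (kappa_tmul N l' n').symm)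

end LiePairTensor

section

open LiePairTensor

variable {F : Type u} [CommRing F] {L : Type v} [LieRing L] [LieAlgebra F L] {N : LieIdeal F L}

instance isLieAbelian_lieJ2 : IsLieAbelian (lieJ2 N) where
  trivial s t := by
    have hs : kappa N s = 0 := s.2
    refine Subtype.ext ((lie_eq_tmul (s : LiePairTensor N) t).trans ?_)
    rw [hs, LieTensor.zero_tmul]
    rfl

instance isLieAbelian_modLie : IsLieAbelian N.modLie where
  trivial x y := by
    obtain ⟨x, rfl⟩ := LieSubmodule.Quotient.surjective_mk' _ x
    obtain ⟨y, rfl⟩ := LieSubmodule.Quotient.surjective_mk' _ y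
    refine (LieSubmodule.Quotient.mk_eq_zero' (m := ⁅x, y⁆)).2 (LieIdeal.mem_comap.2 ?_)
    exact LieSubmodule.lie_mem_lie x.2 (LieSubmodule.mem_top (y : L))

end

/-! ### Central extensions of a free product -/

section CentralExtension

open LieModule.Cohomology LieAlgebra

variable {R : Type u} [CommRing R]

section

variable {K L M : Type*} [LieRing K] [LieAlgebra R K] [LieRing L] [LieAlgebra R L]
  [AddCommGroup M] [Module R M] [LieRingModule L M] [LieModule R L M]

/-- The projection of the extension defined by a 2-cocycle. -/
def ofTwoCocycleFst (c : twoCocycle R L M) : LieAlgebra.ofTwoCocycle c →ₗ⁅R⁆ L where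
  toFun z := ((ofProd c).symm z).1
  map_add' _ _ := rfl
  map_smul' _ _ := rfl
  map_lie' := rfl

/-- The homomorphism `x ↦ (f x, s x)` into the central extension defined by a 2-cocycle `c`, for a
linear map `s` trivializing the pullback of `c` along `f`. -/
def ofTwoCocycleLift [LieModule.IsTrivial L M] (c : twoCocycle R L M) (f : K →ₗ⁅R⁆ L)
    (s : K →ₗ[R] M) (h : ∀ x y, s ⁅x, y⁆ = c.1 (f x) (f y)) :
    K →ₗ⁅R⁆ LieAlgebra.ofTwoCocycle c where
  toFun x := ofProd c (f x, s x)
  map_add' x y := by rw [map_add, map_add, ← of_add, Prod.mk_add_mk]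
  map_smul' a x := by rw [map_smul, map_smul, RingHom.id_apply, ← of_smul, Prod.smul_mk]
  map_lie' {x y} := by simp [bracket_ofTwoCocycle, h, trivial_lie_zero]

end

variable {L₁ : Type v} [LieRing L₁] [LieAlgebra R L₁] {L₂ : Type w} [LieRing L₂] [LieAlgebra R L₂]

/-- A primitive of `c` is the second component of a homomorphism from the free product to the
central extension defined by `c`. -/
theorem LieFreeProduct.exists_primitive {M : Type*} [AddCommGroup M] [Module R M]
    [LieRingModule (LieFreeProduct R L₁ L₂) M] [LieModule R (LieFreeProduct R L₁ L₂) M]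
    [LieModule.IsTrivial (LieFreeProduct R L₁ L₂) M]
    (c : twoCocycle R (LieFreeProduct R L₁ L₂) M) (s₁ : L₁ →ₗ[R] M) (s₂ : L₂ →ₗ[R] M)
    (h₁ : ∀ x y, s₁ ⁅x, y⁆ = c.1 (inl R L₁ L₂ x) (inl R L₁ L₂ y))
    (h₂ : ∀ x y, s₂ ⁅x, y⁆ = c.1 (inr R L₁ L₂ x) (inr R L₁ L₂ y)) :
    ∃ s : LieFreeProduct R L₁ L₂ →ₗ[R] M, ∀ x y, s ⁅x, y⁆ = c.1 x y := by
  let σ := lift (ofTwoCocycleLift c (inl R L₁ L₂) s₁ h₁) (ofTwoCocycleLift c (inr R L₁ L₂) s₂ h₂)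
  have hfst : (ofTwoCocycleFst c).comp σ = 1 :=
    hom_ext (fun x => congrArg (ofTwoCocycleFst c) (lift_inl _ _ x)) fun y =>
      congrArg (ofTwoCocycleFst c) (lift_inr _ _ y)
  let s : LieFreeProduct R L₁ L₂ →ₗ[R] M :=
    { toFun := fun x => ((ofProd c).symm (σ x)).2
      map_add' := fun x y => by rw [map_add, of_symm_add, Prod.snd_add]
      map_smul' := fun a x => by rw [map_smul, of_symm_smul, Prod.smul_snd, RingHom.id_apply] }
  refine ⟨s, fun x y => ?_⟩
  have hσ (z) : ((ofProd c).symm (σ z)).1 = z := LieHom.congr_fun hfst z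
  change ((ofProd c).symm (σ ⁅x, y⁆)).2 = _
  simp [LieHom.map_lie, bracket_ofTwoCocycle, hσ, trivial_lie_zero]

end CentralExtension

/-! ### Tensor squares of free products and direct sums -/

/-- The abelianization `L / [L, L]` of a Lie algebra. -/
abbrev LieAb (F : Type u) [CommRing F] (L : Type v) [LieRing L] [LieAlgebra F L] : Type v :=
  (⊤ : LieIdeal F L).modLie

namespace LieAb

variable {F : Type u} [CommRing F]

section

variable {L : Type v} [LieRing L] [LieAlgebra F L] {V : Type*} [AddCommGroup V] [Module F V]

variable (F) in
/-- The class of an element in the abelianization. -/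
def mk : L →ₗ[F] LieAb F L :=
  (LieIdeal.comap (⊤ : LieIdeal F L).incl ⁅⊤, (⊤ : LieIdeal F L)⁆).toSubmodule.mkQ ∘ₗ
    LinearMap.id.codRestrict (⊤ : LieIdeal F L).toSubmodule fun _ => Submodule.mem_top

theorem mk_surjective : Function.Surjective (mk F : L →ₗ[F] LieAb F L) := fun y =>
  let ⟨x, hx⟩ := Submodule.mkQ_surjective _ y
  ⟨x, hx⟩

@[simp]
theorem mk_lie (x y : L) : mk F ⁅x, y⁆ = 0 :=
  (Submodule.Quotient.mk_eq_zero _).2 <|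
    LieSubmodule.lie_mem_lie (I := (⊤ : LieIdeal F L)) (LieSubmodule.mem_top x)
      (LieSubmodule.mem_top y)

/-- The linear map on the abelianization given by a linear map which vanishes on brackets. -/
def lift (f : L →ₗ[F] V) (hf : ∀ x y : L, f ⁅x, y⁆ = 0) : LieAb F L →ₗ[F] V :=
  Submodule.liftQ _ (f ∘ₗ (⊤ : LieIdeal F L).toSubmodule.subtype) fun x hx => by
    have hx' : (x : L) ∈ (⁅(⊤ : LieIdeal F L), (⊤ : LieIdeal F L)⁆ : LieIdeal F L).toSubmodule := hx
    rw [LieSubmodule.lieIdeal_oper_eq_linear_span] at hx'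
    refine (Submodule.span_le (p := LinearMap.ker f)).2 ?_ hx'
    rintro _ ⟨a, b, rfl⟩
    exact hf a b

end

variable {L₁ : Type v} [LieRing L₁] [LieAlgebra F L₁] {L₂ : Type w} [LieRing L₂] [LieAlgebra F L₂]
  {V : Type*} [AddCommGroup V] [Module F V]

/-- The linear map on the tensor product of two abelianizations given by a bilinear map which
vanishes on brackets in both arguments. -/
def tensorLift (β : L₁ →ₗ[F] L₂ →ₗ[F] V) (h₁ : ∀ (x x' : L₁) y, β ⁅x, x'⁆ y = 0)
    (h₂ : ∀ x (y y' : L₂), β x ⁅y, y'⁆ = 0) : LieAb F L₁ ⊗[F] LieAb F L₂ →ₗ[F] V :=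
  let β' : L₁ →ₗ[F] LieAb F L₂ →ₗ[F] V :=
    (lift β.flip fun y y' => LinearMap.ext fun x => h₂ x y y').flip
  TensorProduct.lift <| lift β' fun x x' => LinearMap.ext <| mk_surjective.forall.2 (h₁ x x')

theorem tensor_ext {f g : LieAb F L₁ ⊗[F] LieAb F L₂ →ₗ[F] V}
    (h : ∀ x y, f (mk F x ⊗ₜ mk F y) = g (mk F x ⊗ₜ mk F y)) : f = g :=
  TensorProduct.ext' <| mk_surjective.forall.2 fun x => mk_surjective.forall.2 (h x)

end LieAb

/-- The nonabelian tensor square `L ⊗ L` of a Lie algebra. -/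
abbrev LieTensorSquare (F : Type u) [CommRing F] (L : Type v) [LieRing L] [LieAlgebra F L] :
    Type (max u v) :=
  LiePairTensor (⊤ : LieIdeal F L)

namespace LieTensorSquare

open LieTensor LiePairTensor

variable {F : Type u} [CommRing F]

section

variable {L : Type v} [LieRing L] [LieAlgebra F L]

variable (F) in
/-- The map `(x, y) ↦ x ⊗ y` into the nonabelian tensor square. -/
def mk : L →ₗ[F] L →ₗ[F] LieTensorSquare F L :=
  (tmulₗ _ _).compl₂ (LinearMap.id.codRestrict (⊤ : LieIdeal F L).toSubmodule
    fun _ => Submodule.mem_top)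

@[simp]
theorem kappa_mk (x y : L) : kappa ⊤ (mk F x y) = ⁅x, y⁆ := kappa_tmul _ _ _

theorem lie_mk (x y z : L) : mk F ⁅x, y⁆ z = mk F x ⁅y, z⁆ - mk F y ⁅x, z⁆ :=
  lie_tmul (LieIdeal.actLeft ⊤) (LieIdeal.actRight ⊤) x y ⟨z, LieSubmodule.mem_top z⟩

theorem mk_lie (x y z : L) : mk F x ⁅y, z⁆ = mk F ⁅z, x⁆ y - mk F ⁅y, x⁆ z := by
  have h := tmul_lie (LieIdeal.actLeft ⊤) (LieIdeal.actRight ⊤) x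
    ⟨y, LieSubmodule.mem_top (R := F) y⟩ ⟨z, LieSubmodule.mem_top z⟩
  rwa [LieIdeal.actRight_apply, LieIdeal.actRight_apply] at h

theorem mk_lie_add_lie_mk (x y z : L) : mk F x ⁅y, z⁆ + mk F ⁅y, z⁆ x = 0 := by
  have h := mk_lie (F := F) x y z
  rw [lie_mk, lie_mk, ← lie_skew z y, map_neg] at h
  rw [lie_mk, ← lie_skew z x, ← lie_skew y x, map_neg, map_neg]
  linear_combination (norm := module) -h

theorem mk_kappa_add_kappa_mk (x : L) (t : LieTensorSquare F L) :
    mk F x (kappa ⊤ t) + mk F (kappa ⊤ t) x = 0 := by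
  induction t using LieTensor.induction_on with
  | tmul l n => rw [kappa_tmul, mk_lie_add_lie_mk]
  | add s t hs ht =>
    rw [map_add, map_add, map_add, LinearMap.add_apply, add_add_add_comm, hs, ht, add_zero]

theorem mk_kappa_kappa (s t : LieTensorSquare F L) : mk F (kappa ⊤ s) (kappa ⊤ t) = ⁅s, t⁆ :=
  (lie_eq_tmul s t).symm

theorem linearMap_ext {V : Type*} [AddCommGroup V] [Module F V] {f g : LieTensorSquare F L →ₗ[F] V}
    (h : ∀ x y, f (mk F x y) = g (mk F x y)) : f = g :=
  LieTensor.linearMap_ext fun x y => h x y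

end

section Maps

variable {M : Type*} [LieRing M] [LieAlgebra F M]
  {L₁ : Type v} [LieRing L₁] [LieAlgebra F L₁] {L₂ : Type w} [LieRing L₂] [LieAlgebra F L₂]

/-- Functoriality of the nonabelian tensor square. -/
def map (f : L₁ →ₗ⁅F⁆ L₂) : LieTensorSquare F L₁ →ₗ⁅F⁆ LieTensorSquare F L₂ :=
  LiePairTensor.map f fun _ _ => LieSubmodule.mem_top _

@[simp]
theorem map_mk (f : L₁ →ₗ⁅F⁆ L₂) (x y : L₁) : map f (mk F x y) = mk F (f x) (f y) :=
  map_tmul _ _ _ _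

@[simp]
theorem kappa_map (f : L₁ →ₗ⁅F⁆ L₂) (t : LieTensorSquare F L₁) :
    kappa ⊤ (map f t) = f (kappa ⊤ t) :=
  LiePairTensor.kappa_map f _ t

/-- The map `x ⊗ y ↦ f x ⊗ g y + g y ⊗ f x`, which factors through the abelianizations and takes
its values in `J₂`. -/
def symmetrized (f : L₁ →ₗ⁅F⁆ M) (g : L₂ →ₗ⁅F⁆ M) :
    LieAb F L₁ ⊗[F] LieAb F L₂ →ₗ[F] LieTensorSquare F M :=
  LieAb.tensorLift ((mk F + (mk F).flip).compl₁₂ (f : L₁ →ₗ[F] M) (g : L₂ →ₗ[F] M))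
    (fun x x' y => by
      have h := mk_lie_add_lie_mk (F := F) (g y) (f x) (f x')
      simpa [add_comm] using h)
    (fun x y y' => by
      have h := mk_lie_add_lie_mk (F := F) (f x) (g y) (g y')
      simpa using h)

@[simp]
theorem symmetrized_tmul (f : L₁ →ₗ⁅F⁆ M) (g : L₂ →ₗ⁅F⁆ M) (x : L₁) (y : L₂) :
    symmetrized f g (LieAb.mk F x ⊗ₜ LieAb.mk F y) = mk F (f x) (g y) + mk F (g y) (f x) := rfl

theorem kappa_symmetrized (f : L₁ →ₗ⁅F⁆ M) (g : L₂ →ₗ⁅F⁆ M) (u : LieAb F L₁ ⊗[F] LieAb F L₂) :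
    kappa ⊤ (symmetrized f g u) = 0 := by
  have h : (kappa (⊤ : LieIdeal F M) : LiePairTensor _ →ₗ[F] M) ∘ₗ symmetrized f g = 0 :=
    LieAb.tensor_ext fun x y => by simp [-lie_skew, ← lie_skew (f x)]
  exact LinearMap.congr_fun h u

/-- The map `x ⊗ y ↦ f x ⊗ g y` for homomorphisms with commuting images, which factors through the
abelianizations. -/
def cross (f : L₁ →ₗ⁅F⁆ M) (g : L₂ →ₗ⁅F⁆ M) (h : ∀ x y, ⁅f x, g y⁆ = 0) :
    LieAb F L₁ ⊗[F] LieAb F L₂ →ₗ[F] LieTensorSquare F M :=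
  LieAb.tensorLift ((mk F).compl₁₂ (f : L₁ →ₗ[F] M) (g : L₂ →ₗ[F] M))
    (fun x x' y => by simp [lie_mk, h])
    (fun x y y' => by simp [mk_lie, ← lie_skew _ (f x), h])

@[simp]
theorem cross_tmul (f : L₁ →ₗ⁅F⁆ M) (g : L₂ →ₗ⁅F⁆ M) (h : ∀ x y, ⁅f x, g y⁆ = 0)
    (x : L₁) (y : L₂) : cross f g h (LieAb.mk F x ⊗ₜ LieAb.mk F y) = mk F (f x) (g y) := rfl

theorem kappa_cross (f : L₁ →ₗ⁅F⁆ M) (g : L₂ →ₗ⁅F⁆ M) (h : ∀ x y, ⁅f x, g y⁆ = 0)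
    (u : LieAb F L₁ ⊗[F] LieAb F L₂) : kappa ⊤ (cross f g h u) = 0 := by
  have hκ : (kappa (⊤ : LieIdeal F M) : LiePairTensor _ →ₗ[F] M) ∘ₗ cross f g h = 0 :=
    LieAb.tensor_ext fun x y => by simp [h]
  exact LinearMap.congr_fun hκ u

/-- The map `x ⊗ y ↦ f x ⊗ g y` from the nonabelian tensor square to the tensor product of the
abelianizations. -/
def toAbTensor (f : M →ₗ⁅F⁆ L₁) (g : M →ₗ⁅F⁆ L₂) :
    LieTensorSquare F M →ₗ[F] LieAb F L₁ ⊗[F] LieAb F L₂ :=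
  liftLinear ((TensorProduct.mk F (LieAb F L₁) (LieAb F L₂)).compl₁₂
    (LieAb.mk F ∘ₗ (f : M →ₗ[F] L₁)) (LieAb.mk F ∘ₗ (g.comp (⊤ : LieIdeal F M).incl : _ →ₗ[F] L₂)))
    (fun l l' n => by
      change LieAb.mk F (f ⁅l, l'⁆) ⊗ₜ LieAb.mk F (g n) = LieAb.mk F (f l) ⊗ₜ
        LieAb.mk F (g ⁅l', (n : M)⁆) - LieAb.mk F (f l') ⊗ₜ LieAb.mk F (g ⁅l, (n : M)⁆)
      simp)
    (fun l n n' => by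
      change LieAb.mk F (f l) ⊗ₜ LieAb.mk F (g ⁅(n : M), (n' : M)⁆) = _
      simp)
    (by simp)

@[simp]
theorem toAbTensor_mk (f : M →ₗ⁅F⁆ L₁) (g : M →ₗ⁅F⁆ L₂) (x y : M) :
    toAbTensor f g (mk F x y) = LieAb.mk F (f x) ⊗ₜ LieAb.mk F (g y) :=
  liftLinear_tmul _ _ _ _ _ _

end Maps

end LieTensorSquare

section FreeProductSquare

open LieFreeProduct LiePairTensor LieTensorSquare

variable {F : Type u} [CommRing F] {L₁ : Type v} [LieRing L₁] [LieAlgebra F L₁]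
  {L₂ : Type w} [LieRing L₂] [LieAlgebra F L₂]

theorem LieFreeProduct.exists_eq_add_kappa (z : LieFreeProduct F L₁ L₂) :
    ∃ x y t, z = inl F L₁ L₂ x + inr F L₁ L₂ y + kappa (⊤ : LieIdeal F _) t := by
  let S : LieSubalgebra F (LieFreeProduct F L₁ L₂) :=
    { LinearMap.range (((inl F L₁ L₂ : L₁ →ₗ[F] LieFreeProduct F L₁ L₂).coprod
        (inr F L₁ L₂ : L₂ →ₗ[F] LieFreeProduct F L₁ L₂)).coprod
          (kappa (⊤ : LieIdeal F (LieFreeProduct F L₁ L₂)) : LiePairTensor _ →ₗ[F] _)) with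
      lie_mem' := fun {a b} _ _ => ⟨((0, 0), mk F a b), by simp⟩ }
  have hS : S = ⊤ := eq_top_of_forall_mem (fun x => ⟨((x, 0), 0), by simp⟩)
    fun y => ⟨((0, y), 0), by simp⟩
  obtain ⟨⟨⟨x, y⟩, t⟩, hz⟩ := hS.ge (LieSubalgebra.mem_top z)
  exact ⟨x, y, t, by simpa using hz.symm⟩

namespace LieTensorSquare

variable {V : Type*} [AddCommGroup V] [Module F V]

/-- The bilinear form of a linear map `q` on the nonabelian tensor square which vanishes on the
squares `z ⊗ z`, as a 2-cocycle with trivial coefficients. -/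
def twoCocycleOf {L : Type*} [LieRing L] [LieAlgebra F L] (q : LieTensorSquare F L →ₗ[F] V)
    (hq : ∀ z, q (mk F z z) = 0) :
    LieModule.Cohomology.twoCocycle F L (TrivialLieModule F L V) :=
  ⟨⟨(mk F).compr₂ (q : LieTensorSquare F L →ₗ[F] TrivialLieModule F L V), hq⟩,
    (LieModule.Cohomology.mem_twoCocycle_iff_of_trivial ..).2 fun x y z => by
      change q (mk F x ⁅y, z⁆) = q (mk F ⁅x, y⁆ z) + q (mk F y ⁅x, z⁆)
      rw [lie_mk, map_sub, sub_add_cancel]⟩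

variable (q : LieTensorSquare F (LieFreeProduct F L₁ L₂) →ₗ[F] V)

theorem apply_mk_self_eq_zero (h₁ : ∀ t, q (map (inl F L₁ L₂) t) = 0)
    (h₂ : ∀ t, q (map (inr F L₁ L₂) t) = 0)
    (h : ∀ u, q (symmetrized (inl F L₁ L₂) (inr F L₁ L₂) u) = 0) (z : LieFreeProduct F L₁ L₂) :
    q (mk F z z) = 0 := by
  obtain ⟨x, y, t, rfl⟩ := exists_eq_add_kappa z
  have hx := h₁ (mk F x x)
  have hy := h₂ (mk F y y)
  have hxy := h (LieAb.mk F x ⊗ₜ LieAb.mk F y)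
  have hxt := congrArg q (mk_kappa_add_kappa_mk (inl F L₁ L₂ x) t)
  have hyt := congrArg q (mk_kappa_add_kappa_mk (inr F L₁ L₂ y) t)
  have htt : mk F (kappa ⊤ t) (kappa ⊤ t) = 0 := by rw [mk_kappa_kappa, lie_self]
  simp only [map_mk, symmetrized_tmul, map_add, map_zero] at hx hy hxy hxt hyt
  simp only [map_add, LinearMap.add_apply, hx, hy, htt, map_zero]
  linear_combination (norm := module) hxy + hxt + hyt

theorem exists_eq_comp_kappa (h₁ : ∀ t, q (map (inl F L₁ L₂) t) = 0)
    (h₂ : ∀ t, q (map (inr F L₁ L₂) t) = 0)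
    (h : ∀ u, q (symmetrized (inl F L₁ L₂) (inr F L₁ L₂) u) = 0) :
    ∃ s : LieFreeProduct F L₁ L₂ →ₗ[F] V, ∀ t, q t = s (kappa ⊤ t) := by
  obtain ⟨s, hs⟩ := exists_primitive (twoCocycleOf q (apply_mk_self_eq_zero q h₁ h₂ h)) 0 0
    (fun x y => ((congrArg q (map_mk _ x y)).symm.trans (h₁ _)).symm)
    (fun x y => ((congrArg q (map_mk _ x y)).symm.trans (h₂ _)).symm)
  let s' : LieFreeProduct F L₁ L₂ →ₗ[F] V := s
  have hqs : q =
      s' ∘ₗ (kappa (⊤ : LieIdeal F (LieFreeProduct F L₁ L₂)) : LiePairTensor _ →ₗ[F] _) :=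
    LieTensorSquare.linearMap_ext fun x y => ((congrArg s (kappa_mk x y)).trans (hs x y)).symm
  exact ⟨s', LinearMap.congr_fun hqs⟩

theorem exists_eq_map_add_map_add_symmetrized {t : LieTensorSquare F (LieFreeProduct F L₁ L₂)}
    (ht : kappa ⊤ t = 0) : ∃ a b u, t =
      map (inl F L₁ L₂) a + map (inr F L₁ L₂) b + symmetrized (inl F L₁ L₂) (inr F L₁ L₂) u := by
  let B := LinearMap.range (((map (inl F L₁ L₂) : LieTensorSquare F L₁ →ₗ[F] _).coprod
    (map (inr F L₁ L₂) : LieTensorSquare F L₂ →ₗ[F] _)).coprod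
      (symmetrized (inl F L₁ L₂) (inr F L₁ L₂)))
  obtain ⟨s, hs⟩ := exists_eq_comp_kappa B.mkQ
    (fun a => (Submodule.Quotient.mk_eq_zero B).2 ⟨((a, 0), 0), by simp⟩)
    (fun b => (Submodule.Quotient.mk_eq_zero B).2 ⟨((0, b), 0), by simp⟩)
    (fun u => (Submodule.Quotient.mk_eq_zero B).2 ⟨((0, 0), u), by simp⟩)
  have htB : t ∈ B := (Submodule.Quotient.mk_eq_zero B).1 ((hs t).trans (by rw [ht, map_zero]))
  obtain ⟨⟨⟨a, b⟩, u⟩, rfl⟩ := htB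
  exact ⟨a, b, u, by simp⟩

end LieTensorSquare

end FreeProductSquare

namespace LieTensorSquare

open LieFreeProduct LiePairTensor

variable {F : Type u} [CommRing F] {L₁ : Type v} [LieRing L₁] [LieAlgebra F L₁]
  {L₂ : Type w} [LieRing L₂] [LieAlgebra F L₂]

theorem mk_eq_add_add_add (x y : L₁ × L₂) : mk F x y =
    mk F (x.1, 0) (y.1, 0) + mk F (0, x.2) (0, y.2) + mk F (x.1, 0) (0, y.2) +
      mk F (0, x.2) (y.1, 0) := by
  conv_lhs => rw [← Prod.fst_add_snd x, ← Prod.fst_add_snd y]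
  simp only [map_add, LinearMap.add_apply]
  abel

variable (F L₁ L₂) in
/-- The decomposition of the nonabelian tensor square of a direct sum into the tensor squares of
the summands and the two mixed parts. -/
def prodEquiv : LieTensorSquare F (L₁ × L₂) ≃ₗ[F] LieTensorSquare F L₁ × LieTensorSquare F L₂ ×
    (LieAb F L₁ ⊗[F] LieAb F L₂) × (LieAb F L₂ ⊗[F] LieAb F L₁) :=
  LinearEquiv.ofLinearMap
    ((map (LieHom.fst F L₁ L₂) : LieTensorSquare F _ →ₗ[F] _).prod <|
      (map (LieHom.snd F L₁ L₂) : LieTensorSquare F _ →ₗ[F] _).prod <|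
      (toAbTensor (LieHom.fst F L₁ L₂) (LieHom.snd F L₁ L₂)).prod
        (toAbTensor (LieHom.snd F L₁ L₂) (LieHom.fst F L₁ L₂)))
    ((map (LieHom.inl F L₁ L₂) : LieTensorSquare F _ →ₗ[F] _).coprod <|
      (map (LieHom.inr F L₁ L₂) : LieTensorSquare F _ →ₗ[F] _).coprod <|
      (cross (LieHom.inl F L₁ L₂) (LieHom.inr F L₁ L₂) (by simp)).coprod
        (cross (LieHom.inr F L₁ L₂) (LieHom.inl F L₁ L₂) (by simp)))
    (LinearMap.prod_ext (linearMap_ext fun x y => by simp) <|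
      LinearMap.prod_ext (linearMap_ext fun x y => by simp) <|
      LinearMap.prod_ext (LieAb.tensor_ext fun x y => by simp)
        (LieAb.tensor_ext fun x y => by simp))
    (linearMap_ext fun x y => by simp [mk_eq_add_add_add x y, add_assoc])

@[simp]
theorem prodEquiv_mk (x y : L₁ × L₂) : prodEquiv F L₁ L₂ (mk F x y) =
    (mk F x.1 y.1, mk F x.2 y.2, LieAb.mk F x.1 ⊗ₜ LieAb.mk F y.2,
      LieAb.mk F x.2 ⊗ₜ LieAb.mk F y.1) := by
  simp [prodEquiv]

theorem kappa_eq_kappa_prodEquiv (t : LieTensorSquare F (L₁ × L₂)) : kappa ⊤ t =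
    (kappa ⊤ (prodEquiv F L₁ L₂ t).1, kappa ⊤ (prodEquiv F L₁ L₂ t).2.1) :=
  (Prod.ext (kappa_map (LieHom.fst F L₁ L₂) t) (kappa_map (LieHom.snd F L₁ L₂) t)).symm

theorem prodEquiv_map_toProd (a : LieTensorSquare F L₁) (b : LieTensorSquare F L₂)
    (u : LieAb F L₁ ⊗[F] LieAb F L₂) :
    prodEquiv F L₁ L₂ (map (toProd F L₁ L₂) (map (inl F L₁ L₂) a + map (inr F L₁ L₂) b +
      symmetrized (inl F L₁ L₂) (inr F L₁ L₂) u)) = (a, b, u, TensorProduct.comm F _ _ u) := by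
  let f : LieTensorSquare F (LieFreeProduct F L₁ L₂) →ₗ[F] _ :=
    (prodEquiv F L₁ L₂).toLinearMap ∘ₗ
      (map (toProd F L₁ L₂) : LieTensorSquare F _ →ₗ[F] LieTensorSquare F (L₁ × L₂))
  have ha : f (map (inl F L₁ L₂) a) = (a, 0, 0, 0) :=
    LinearMap.congr_fun (f := f ∘ₗ (map (inl F L₁ L₂) : LieTensorSquare F L₁ →ₗ[F] _))
      (g := LinearMap.inl ..) (linearMap_ext fun x y => by simp [f, toProd_inl]) a
  have hb : f (map (inr F L₁ L₂) b) = (0, b, 0, 0) :=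
    LinearMap.congr_fun (f := f ∘ₗ (map (inr F L₁ L₂) : LieTensorSquare F L₂ →ₗ[F] _))
      (g := LinearMap.inr .. ∘ₗ LinearMap.inl ..)
      (linearMap_ext fun x y => by simp [f, toProd_inr]) b
  have hu : f (symmetrized (inl F L₁ L₂) (inr F L₁ L₂) u) = (0, 0, u, TensorProduct.comm F _ _ u) :=
    LinearMap.congr_fun (f := f ∘ₗ symmetrized (inl F L₁ L₂) (inr F L₁ L₂))
      (g := LinearMap.inr .. ∘ₗ LinearMap.inr .. ∘ₗ
        LinearMap.id.prod (TensorProduct.comm F _ _).toLinearMap)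
      (LieAb.tensor_ext fun x y => by simp [f, toProd_inl, toProd_inr]) u
  change f _ = _
  rw [map_add, map_add, ha, hb, hu]
  simp

end LieTensorSquare

section

variable {F L M V : Type*} [CommRing F] [LieRing L] [LieAlgebra F L] [LieRing M] [LieAlgebra F M]
  [AddCommGroup V] [Module F V]

/-- The first isomorphism theorem for the cokernel of a homomorphism to an abelian Lie algebra. -/
def quotIdealRangeEquiv [IsLieAbelian M] (f : L →ₗ⁅F⁆ M) (g : M →ₗ[F] V)
    (hg : Function.Surjective g) (h : ∀ y, g y = 0 ↔ ∃ x, f x = y) : (M ⧸ f.idealRange) ≃ₗ[F] V :=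
  have hker : f.idealRange.toSubmodule = LinearMap.ker g := by
    ext y
    exact (f.mem_idealRange_iff (isIdealMorphism_of_isLieAbelian f)).trans (h y).symm
  (Submodule.quotEquivOfEq _ _ hker).trans (g.quotKerEquivOfSurjective hg)

end

namespace LieTensorSquare

open LieFreeProduct LiePairTensor

variable {F : Type u} [CommRing F] {L₁ : Type v} [LieRing L₁] [LieAlgebra F L₁]
  {L₂ : Type w} [LieRing L₂] [LieAlgebra F L₂]

theorem eq_zero_of_map_toProd_eq_zero {t : LieTensorSquare F (LieFreeProduct F L₁ L₂)}
    (ht : kappa ⊤ t = 0) (h : map (toProd F L₁ L₂) t = 0) : t = 0 := by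
  obtain ⟨a, b, u, rfl⟩ := exists_eq_map_add_map_add_symmetrized ht
  have hab := prodEquiv_map_toProd a b u
  rw [h, map_zero] at hab
  simp only [Prod.ext_iff, Prod.fst_zero, Prod.snd_zero] at hab
  obtain ⟨rfl, rfl, rfl, -⟩ := hab
  simp

variable (F L₁ L₂) in
/-- The obstruction to lifting an element of `J₂(L₁ ⊕ L₂)` to `J₂(L₁ * L₂)`: the difference of its
two mixed parts. -/
def mixedDifference : LieTensorSquare F (L₁ × L₂) →ₗ[F] LieAb F L₁ ⊗[F] LieAb F L₂ :=
  toAbTensor (LieHom.fst F L₁ L₂) (LieHom.snd F L₁ L₂) -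
    (TensorProduct.comm F _ _).toLinearMap ∘ₗ
      toAbTensor (LieHom.snd F L₁ L₂) (LieHom.fst F L₁ L₂)

theorem mixedDifference_apply (t : LieTensorSquare F (L₁ × L₂)) : mixedDifference F L₁ L₂ t =
    (prodEquiv F L₁ L₂ t).2.2.1 - TensorProduct.comm F _ _ (prodEquiv F L₁ L₂ t).2.2.2 := rfl

theorem mixedDifference_cross (u : LieAb F L₁ ⊗[F] LieAb F L₂) :
    mixedDifference F L₁ L₂ (cross (LieHom.inl F L₁ L₂) (LieHom.inr F L₁ L₂) (by simp) u) = u :=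
  LinearMap.congr_fun
    (f := mixedDifference F L₁ L₂ ∘ₗ cross (LieHom.inl F L₁ L₂) (LieHom.inr F L₁ L₂) (by simp))
    (g := LinearMap.id) (LieAb.tensor_ext fun x y => by simp [mixedDifference]) u

theorem mixedDifference_eq_zero_iff {t : LieTensorSquare F (L₁ × L₂)} (ht : kappa ⊤ t = 0) :
    mixedDifference F L₁ L₂ t = 0 ↔
      ∃ s : LieTensorSquare F (LieFreeProduct F L₁ L₂), kappa ⊤ s = 0 ∧
        map (toProd F L₁ L₂) s = t := by
  constructor
  · rw [mixedDifference_apply, sub_eq_zero]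
    intro h
    rw [kappa_eq_kappa_prodEquiv, Prod.mk_eq_zero] at ht
    refine ⟨_, ?_, (prodEquiv F L₁ L₂).injective <| (prodEquiv_map_toProd (prodEquiv F L₁ L₂ t).1
      (prodEquiv F L₁ L₂ t).2.1 (prodEquiv F L₁ L₂ t).2.2.1).trans ?_⟩
    · rw [map_add, map_add, kappa_map, kappa_map, kappa_symmetrized, ht.1, ht.2]
      simp
    · have hcomm : TensorProduct.comm F _ _ (prodEquiv F L₁ L₂ t).2.2.1 =
          (prodEquiv F L₁ L₂ t).2.2.2 := by rw [h, TensorProduct.comm_comm]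
      rw [hcomm]
  · rintro ⟨s, hs, rfl⟩
    obtain ⟨a, b, u, rfl⟩ := exists_eq_map_add_map_add_symmetrized hs
    rw [mixedDifference_apply, prodEquiv_map_toProd, TensorProduct.comm_comm, sub_self]

end LieTensorSquare

section

open LieFreeProduct LiePairTensor LieTensorSquare

variable {F : Type u} [CommRing F] {L₁ : Type v} [LieRing L₁] [LieAlgebra F L₁]
  {L₂ : Type w} [LieRing L₂] [LieAlgebra F L₂]
  {N : LieIdeal F (LieFreeProduct F L₁ L₂)} {P : LieIdeal F (L₁ × L₂)}

theorem lieJ2Map_toProd_injective_of_eq_top (hN : N = ⊤) (hP : P = ⊤)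
    (h : ∀ x ∈ N, toProd F L₁ L₂ x ∈ P) : Function.Injective (lieJ2Map (toProd F L₁ L₂) h) := by
  subst hN hP
  exact (injective_iff_map_eq_zero _).2 fun t ht =>
    Subtype.ext (eq_zero_of_map_toProd_eq_zero t.2 (congrArg Subtype.val ht))

/-- The cokernel of `J₂(L₁ * L₂) → J₂(L₁ ⊕ L₂)`, identified by the difference of the mixed
parts. -/
def quotIdealRangeLieJ2MapEquiv (hN : N = ⊤) (hP : P = ⊤) (h : ∀ x ∈ N, toProd F L₁ L₂ x ∈ P) :
    (lieJ2 P ⧸ (lieJ2Map (toProd F L₁ L₂) h).idealRange) ≃ₗ[F] LieAb F L₁ ⊗[F] LieAb F L₂ := by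
  subst hN hP
  refine quotIdealRangeEquiv _
    (mixedDifference F L₁ L₂ ∘ₗ (lieJ2 (⊤ : LieIdeal F (L₁ × L₂))).toSubmodule.subtype)
    (fun u => ⟨⟨_, kappa_cross _ _ (by simp) u⟩, mixedDifference_cross u⟩) ?_
  rintro ⟨t, ht⟩
  refine (mixedDifference_eq_zero_iff ht).trans ⟨?_, ?_⟩
  · rintro ⟨s, hs, rfl⟩
    exact ⟨⟨s, hs⟩, rfl⟩
  · rintro ⟨s, hs⟩
    exact ⟨s, s.2, congrArg Subtype.val hs⟩

end

/-! ### Arbitrary ideals -/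

namespace LiePairTensor

variable {F : Type u} [CommRing F] {L : Type v} [LieRing L] [LieAlgebra F L]
  {L' : Type w} [LieRing L'] [LieAlgebra F L']

instance subsingleton_bot : Subsingleton (LiePairTensor (⊥ : LieIdeal F L)) :=
  subsingleton_of_forall_eq 0 fun t => by
    induction t using LieTensor.induction_on with
    | tmul l n => rw [Subsingleton.elim n 0, LieTensor.tmul_zero]
    | add s t hs ht => rw [hs, ht, add_zero]

theorem map_map_eq_self {N : LieIdeal F L} {N' : LieIdeal F L'} {f : L →ₗ⁅F⁆ L'}
    {g : L' →ₗ⁅F⁆ L} (hf : ∀ x ∈ N, f x ∈ N') (hg : ∀ x ∈ N', g x ∈ N)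
    (hgf : Function.LeftInverse g f) (t : LiePairTensor N) : map g hg (map f hf t) = t := by
  induction t using LieTensor.induction_on with
  | tmul l n => simp [hgf _]
  | add s t hs ht => rw [map_add, map_add, hs, ht]

end LiePairTensor

section

open LieFreeProduct LiePairTensor

variable {F : Type u} [CommRing F] {L₁ : Type v} [LieRing L₁] [LieAlgebra F L₁]
  {L₂ : Type w} [LieRing L₂] [LieAlgebra F L₂] {N₁ : LieIdeal F L₁} {N₂ : LieIdeal F L₂}
  {N : LieIdeal F (LieFreeProduct F L₁ L₂)}

theorem subsingleton_modLie_of_eq_bot (h : N₁ = ⊥) : Subsingleton N₁.modLie := by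
  subst h
  exact (LieSubmodule.Quotient.surjective_mk' _).subsingleton

theorem LieFreeProduct.eq_bot (hN : N.toLieSubalgebra = (inclusion N₁ N₂).range)
    (h₁ : N₁ = ⊥) (h₂ : N₂ = ⊥) : N = ⊥ := by
  subst h₁ h₂
  have hle : N.toLieSubalgebra ≤ ⊥ := toLieSubalgebra_le hN
    (fun x hx => by simp [(LieSubmodule.mem_bot x).1 hx])
    (fun y hy => by simp [(LieSubmodule.mem_bot y).1 hy])
  exact (LieSubmodule.eq_bot_iff N).2 fun x hx => hle hx

theorem LieFreeProduct.eq_top (hN : N.toLieSubalgebra = (inclusion N₁ N₂).range)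
    (h₁ : N₁ = ⊤) (h₂ : N₂ = ⊤) : N = ⊤ := by
  subst h₁ h₂
  have htop : N.toLieSubalgebra = ⊤ := eq_top_of_forall_mem
    (fun x => inl_mem hN (LieSubmodule.mem_top x)) (fun y => inr_mem hN (LieSubmodule.mem_top y))
  exact eq_top_iff.2 fun x _ => htop.ge (LieSubalgebra.mem_top x)

variable (F L₁ L₂) in
theorem lieIdealProd_bot : lieIdealProd (⊥ : LieIdeal F L₁) (⊥ : LieIdeal F L₂) = ⊥ :=
  (LieSubmodule.eq_bot_iff _).2 fun _ hx => Prod.ext hx.1 hx.2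

variable (F L₁ L₂) in
theorem lieIdealProd_top : lieIdealProd (⊤ : LieIdeal F L₁) (⊤ : LieIdeal F L₂) = ⊤ :=
  eq_top_iff.2 fun x _ => ⟨LieSubmodule.mem_top x.1, LieSubmodule.mem_top x.2⟩

theorem lieJ2ToProd_bijective_of_inverse (hN : N.toLieSubalgebra = (inclusion N₁ N₂).range)
    (s : L₁ × L₂ →ₗ⁅F⁆ LieFreeProduct F L₁ L₂) (hs : ∀ x ∈ lieIdealProd N₁ N₂, s x ∈ N)
    (hleft : Function.LeftInverse s (toProd F L₁ L₂))
    (hright : Function.RightInverse s (toProd F L₁ L₂)) :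
    Function.Bijective (lieJ2ToProd hN) :=
  Function.bijective_iff_has_inverse.2 ⟨lieJ2Map s hs,
    fun t => Subtype.ext (map_map_eq_self (toProd_mem hN) hs hleft t.1),
    fun t => Subtype.ext (map_map_eq_self hs (toProd_mem hN) hright t.1)⟩

theorem lieJ2ToProd_bijective_of_subsingleton_left [Subsingleton L₁]
    (hN : N.toLieSubalgebra = (inclusion N₁ N₂).range) :
    Function.Bijective (lieJ2ToProd hN) := by
  let s := (inr F L₁ L₂).comp (LieHom.snd F L₁ L₂)
  have hs : s.comp (toProd F L₁ L₂) = LieHom.id :=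
    hom_ext (fun x => by simp [Subsingleton.elim x 0]) (fun y => by simp [s, toProd_inr])
  refine lieJ2ToProd_bijective_of_inverse hN s (fun x hx => inr_mem hN hx.2)
    (LieHom.congr_fun hs) fun x => ?_
  exact (toProd_inr x.2).trans (Prod.ext (Subsingleton.elim _ _) rfl)

theorem lieJ2ToProd_bijective_of_subsingleton_right [Subsingleton L₂]
    (hN : N.toLieSubalgebra = (inclusion N₁ N₂).range) :
    Function.Bijective (lieJ2ToProd hN) := by
  let s := (inl F L₁ L₂).comp (LieHom.fst F L₁ L₂)
  have hs : s.comp (toProd F L₁ L₂) = LieHom.id :=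
    hom_ext (fun x => by simp [s, toProd_inl]) (fun y => by simp [Subsingleton.elim y 0])
  refine lieJ2ToProd_bijective_of_inverse hN s (fun x hx => inl_mem hN hx.1)
    (LieHom.congr_fun hs) fun x => ?_
  exact (toProd_inl x.1).trans (Prod.ext rfl (Subsingleton.elim _ _))

theorem lieJ2Map_bijective_of_eq_bot {L L' : Type*} [LieRing L] [LieAlgebra F L] [LieRing L']
    [LieAlgebra F L'] {I : LieIdeal F L} {J : LieIdeal F L'} (hI : I = ⊥) (hJ : J = ⊥)
    (f : L →ₗ⁅F⁆ L') (h : ∀ x ∈ I, f x ∈ J) : Function.Bijective (lieJ2Map f h) := by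
  subst hI hJ
  exact ⟨Function.injective_of_subsingleton _, Function.surjective_to_subsingleton _⟩

end

section

open LieFreeProduct

variable {F : Type u} [Field F] {L₁ : Type v} [LieRing L₁] [LieAlgebra F L₁]
  {L₂ : Type w} [LieRing L₂] [LieAlgebra F L₂] {N₁ : LieIdeal F L₁} {N₂ : LieIdeal F L₂}
  {N : LieIdeal F (LieFreeProduct F L₁ L₂)}

theorem lieJ2ToProd_bijective_or_eq_top (hN : N.toLieSubalgebra = (inclusion N₁ N₂).range) :
    Function.Bijective (lieJ2ToProd hN) ∧ (N₁ = ⊥ ∨ N₂ = ⊥) ∨ N₁ = ⊤ ∧ N₂ = ⊤ := by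
  rcases left_eq_bot_or_right_eq_top hN with h₁ | h₂ <;>
    rcases right_eq_bot_or_left_eq_top hN with h₂' | h₁'
  · exact .inl ⟨lieJ2Map_bijective_of_eq_bot (eq_bot hN h₁ h₂')
      (by rw [h₁, h₂', lieIdealProd_bot]) _ _, .inl h₁⟩
  · have : Subsingleton L₁ := (LieSubmodule.subsingleton_iff F L₁ L₁).1
      (subsingleton_of_bot_eq_top (h₁.symm.trans h₁'))
    exact .inl ⟨lieJ2ToProd_bijective_of_subsingleton_left hN, .inl h₁⟩
  · have : Subsingleton L₂ := (LieSubmodule.subsingleton_iff F L₂ L₂).1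
      (subsingleton_of_bot_eq_top (h₂'.symm.trans h₂))
    exact .inl ⟨lieJ2ToProd_bijective_of_subsingleton_right hN, .inr h₂'⟩
  · exact .inr ⟨h₁', h₂⟩

theorem lieJ2ToProd_injective (hN : N.toLieSubalgebra = (inclusion N₁ N₂).range) :
    Function.Injective (lieJ2ToProd hN) := by
  rcases lieJ2ToProd_bijective_or_eq_top hN with ⟨hbij, -⟩ | ⟨h₁, h₂⟩
  · exact hbij.1
  · exact lieJ2Map_toProd_injective_of_eq_top (eq_top hN h₁ h₂)
      (by rw [h₁, h₂, lieIdealProd_top]) _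

theorem nonempty_quotIdealRange_lieJ2ToProd_equiv
    (hN : N.toLieSubalgebra = (inclusion N₁ N₂).range) :
    Nonempty ((lieJ2 (lieIdealProd N₁ N₂) ⧸ (lieJ2ToProd hN).idealRange) ≃ₗ[F]
      N₁.modLie ⊗[F] N₂.modLie) := by
  rcases lieJ2ToProd_bijective_or_eq_top hN with ⟨hbij, hbot⟩ | ⟨rfl, rfl⟩
  · have : Subsingleton (N₁.modLie ⊗[F] N₂.modLie) := by
      rcases hbot with h₁ | h₂
      · have := subsingleton_modLie_of_eq_bot h₁
        infer_instance
      · have := subsingleton_modLie_of_eq_bot h₂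
        infer_instance
    exact ⟨quotIdealRangeEquiv _ 0 (Function.surjective_to_subsingleton _)
      fun y => iff_of_true rfl (hbij.2 y)⟩
  · exact ⟨quotIdealRangeLieJ2MapEquiv (eq_top hN rfl rfl) (lieIdealProd_top F L₁ L₂)
      (toProd_mem hN)⟩

end

end

theorem mainTheorem5_general {F : Type u} [Field F] {L₁ : Type v} [LieRing L₁] [LieAlgebra F L₁]
    {L₂ : Type w} [LieRing L₂] [LieAlgebra F L₂] (N₁ : LieIdeal F L₁) (N₂ : LieIdeal F L₂)
    (N : LieIdeal F (LieFreeProduct F L₁ L₂))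
    (hN : N.toLieSubalgebra = (LieFreeProduct.inclusion N₁ N₂).range) :
    Function.Injective (lieJ2ToProd hN) ∧ (lieJ2ToProd hN).IsIdealMorphism ∧
    Nonempty ((lieJ2 (lieIdealProd N₁ N₂) ⧸ (lieJ2ToProd hN).idealRange) ≃ₗ⁅F⁆
      LieTensor (0 : N₁.modLie →ₗ⁅F⁆ LieDerivation F N₂.modLie N₂.modLie)
        (0 : N₂.modLie →ₗ⁅F⁆ LieDerivation F N₁.modLie N₁.modLie)) ∧
    Nonempty ((lieJ2 (lieIdealProd N₁ N₂) ⧸ (lieJ2ToProd hN).idealRange) ≃ₗ[F]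
      N₁.modLie ⊗[F] N₂.modLie) := by
  obtain ⟨e⟩ := nonempty_quotIdealRange_lieJ2ToProd_equiv hN
  have := isLieAbelian_quotient (lieJ2ToProd hN).idealRange
  exact ⟨lieJ2ToProd_injective hN, isIdealMorphism_of_isLieAbelian _,
    ⟨lieEquivOfIsLieAbelian (e.trans (LieTensor.equivTensorProduct F _ _).symm)⟩, ⟨e⟩⟩

theorem mainTheorem5 {F : Type u} [Field F]
    {L₁ : Type v} [LieRing L₁] [LieAlgebra F L₁] [FiniteDimensional F L₁]
    {L₂ : Type w} [LieRing L₂] [LieAlgebra F L₂] [FiniteDimensional F L₂]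
    (N₁ : LieIdeal F L₁) (N₂ : LieIdeal F L₂)
    -- `N₁ * N₂` is an ideal `N` of `L₁ * L₂`
    (N : LieIdeal F (LieFreeProduct F L₁ L₂))
    (hN : N.toLieSubalgebra = (LieFreeProduct.inclusion N₁ N₂).range) :
    -- the canonical homomorphism embeds `J₂(L₁ * L₂, N₁ * N₂)` in `J₂(L₁ ⊕ L₂, N₁ ⊕ N₂)`
    -- as an ideal
    Function.Injective (lieJ2ToProd hN) ∧ (lieJ2ToProd hN).IsIdealMorphism ∧
    -- the quotient is the tensor product, in the nonabelian sense with trivial actions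
    Nonempty ((lieJ2 (lieIdealProd N₁ N₂) ⧸ (lieJ2ToProd hN).idealRange) ≃ₗ⁅F⁆
      LieTensor (0 : N₁.modLie →ₗ⁅F⁆ LieDerivation F N₂.modLie N₂.modLie)
        (0 : N₂.modLie →ₗ⁅F⁆ LieDerivation F N₁.modLie N₁.modLie)) ∧
    -- and, as a vector space, the usual one
    Nonempty ((lieJ2 (lieIdealProd N₁ N₂) ⧸ (lieJ2ToProd hN).idealRange) ≃ₗ[F]
      N₁.modLie ⊗[F] N₂.modLie) :=
  mainTheorem5_general N₁ N₂ N hN
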